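/- **Theorem 5.3.** For a finite metric space $(P,\mathsf d)$ and $\alpha\ge 1$, a directed graph $G=(P,E)$ is *$\alpha$-navigable* if for all $s,t\in P$ with $\mathsf d(s,t)>0$ there is an edge $(s,u)\in E$ with $\mathsf d(u,t)<\mathsf d(s,t)/\alpha$. For $\beta\ge\alpha$, $G$ is an *$(\alpha,\beta)$-bicriteria $c$-approximation* to the sparsest navigable graph on $P$ if $G$ is $\alpha$-navigable and, for every $\beta$-navigable graph $H$ on $P$, the maximum out-degree of $G$ is at most $c$ times that of $H$ and the number of edges of $G$ is at most $c$ times that of $H$. The aspect ratio $\Delta$ of $P$ is the maximum distance divided by the minimum nonzero distance. Algorithms run on a word RAM with words of $O(\log n)$ bits that can draw uniform random integers $0\le v<k$ for a word $k$. The real inputs (the distances, $\alpha$, and $\varepsilon$ in the form $1+\varepsilon$) are held exactly in real registers, which can be copied, multiplied or divided by an input number, and compared, each in one step. Let $\omega$ be any exponent such that two $n\times n$ Boolean matrices can be multiplied deterministically in $\widetilde O(n^{\omega})$ steps on the word part of this machine. Here $\widetilde O$ hides factors polylogarithmic in $n$. There is an absolute constant $A$ such that for every such $\omega$ there is a randomized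 algorithm with the following property. Given any $n$-point metric space $(P,\mathsf d)$ with $n\ge 2$ and aspect ratio $\Delta$, any real $\alpha\ge1$ and any $\varepsilon\in(0,1)$, it always halts within $$\widetilde O\!\left(n^{\omega}\left(1+\frac{\log\Delta}{\varepsilon}\right)\right)$$ steps, where the implied constants depend on $\omega$ only, and with probability at least $1-1/n$ it outputs an $(\alpha,\,2\alpha(1+\varepsilon))$-bicriteria $(A\ln n)$-approximation to the sparsest navigable graph on $P$. -/

import Mathlib

/-! Sparse navigable graphs on finite metric spaces, and a randomized word RAM with exact real
inputs on which running times are counted. -/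

namespace SparseNav

/-! ### Navigable graphs -/

section Graphs

variable {P : Type*}

/-- The out-degree of the vertex `s` in the directed graph `G`. -/
noncomputable def outDegree (G : Digraph P) (s : P) : ℕ :=
  {u : P | G.Adj s u}.ncard

/-- The maximum out-degree of a directed graph (used on finite vertex sets only). -/
noncomputable def maxOutDegree (G : Digraph P) : ℕ :=
  ⨆ s : P, outDegree G s

/-- The number of directed edges. -/
noncomputable def edgeCount (G : Digraph P) : ℕ :=
  {p : P × P | G.Adj p.1 p.2}.ncard

/-- `α`-navigability: for all `s`, `t` at positive distance there is an edge `(s, u)` with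
`dist u t < dist s t / α`. -/
def IsNavigable [MetricSpace P] (α : ℝ) (G : Digraph P) : Prop :=
  ∀ s t : P, 0 < dist s t → ∃ u : P, G.Adj s u ∧ dist u t < dist s t / α

/-- `G` is an `(α, β)`-bicriteria `c`-approximation to the sparsest navigable graph, under both
objectives: it is `α`-navigable, and its maximum out-degree and its number of edges are at most
`c` times those of any `β`-navigable graph. -/
def IsBicriteriaApprox [MetricSpace P] (α β c : ℝ) (G : Digraph P) : Prop :=
  IsNavigable α G ∧ ∀ H : Digraph P, IsNavigable β H →
    (maxOutDegree G : ℝ) ≤ c * maxOutDegree H ∧ (edgeCount G : ℝ) ≤ c * edgeCount H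

/-- The aspect ratio: the maximum distance divided by the minimum nonzero distance (used on
finite metric spaces with at least two points). -/
noncomputable def aspectRatio (P : Type*) [MetricSpace P] : ℝ :=
  (⨆ p : P × P, dist p.1 p.2) / (⨅ p : {p : P × P // p.1 ≠ p.2}, dist p.1.1 p.1.2)

end Graphs

/-! ### The machine

A word RAM with words of `w` bits, structured programs and named arrays.  It has, in addition,
real registers.  These can be loaded with a number of the input, copied, multiplied or divided by
a number of the input, and compared.  There is no rounding of reals to words, and no operation
between two computed reals, so that a real register cannot be used to store and process long bit
strings: every program is in particular a program for the usual real RAM. -/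

/-- The real numbers of the input: a matrix of distances and two parameters. -/
structure RealInput where
  /-- the distance of the points with the given numbers -/
  dist : ℕ → ℕ → ℝ
  /-- the navigability parameter -/
  alpha : ℝ
  /-- the number `1 + ε` -/
  oneAddEps : ℝ

/-- The memory: word variables, arrays of words and real registers. -/
structure State where
  var : ℕ → ℕ
  arr : ℕ → ℕ → ℕ
  real : ℕ → ℝ

/-- All variables and array cells hold words of `w` bits. -/
def State.Valid (w : ℕ) (s : State) : Prop :=
  (∀ x, s.var x < 2 ^ w) ∧ ∀ a i, s.arr a i < 2 ^ w

def State.setVar (s : State) (x v : ℕ) : State :=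
  { s with var := Function.update s.var x v }

def State.setArr (s : State) (a i v : ℕ) : State :=
  { s with arr := Function.update s.arr a (Function.update (s.arr a) i v) }

noncomputable def State.setReal (s : State) (r : ℕ) (v : ℝ) : State :=
  { s with real := Function.update s.real r v }

/-- Word expressions.  `read a e` is the cell of the array `a` whose index is the value of `e`. -/
inductive Expr where
  | const (c : ℕ)
  | var (x : ℕ)
  | read (a : ℕ) (i : Expr)
  | add (e f : Expr)
  | sub (e f : Expr)
  | mul (e f : Expr)
  | div (e f : Expr)
  | mod (e f : Expr)
  | lt (e f : Expr)
  | eq (e f : Expr)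

/-- The value of an expression in words of `w` bits.  Sums and products are taken modulo `2 ^ w`;
differences are truncated at zero; `lt` and `eq` return `1` for true and `0` for false. -/
def Expr.eval (w : ℕ) (s : State) : Expr → ℕ
  | const c => c % 2 ^ w
  | var x => s.var x
  | read a i => s.arr a (i.eval w s)
  | add e f => (e.eval w s + f.eval w s) % 2 ^ w
  | sub e f => e.eval w s - f.eval w s
  | mul e f => (e.eval w s * f.eval w s) % 2 ^ w
  | div e f => e.eval w s / f.eval w s
  | mod e f => e.eval w s % f.eval w s
  | lt e f => if e.eval w s < f.eval w s then 1 else 0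
  | eq e f => if e.eval w s = f.eval w s then 1 else 0

/-- References to the real numbers of the input. -/
inductive RealRef where
  | dist (i j : Expr)
  | alpha
  | oneAddEps

def RealRef.eval (w : ℕ) (I : RealInput) (s : State) : RealRef → ℝ
  | dist i j => I.dist (i.eval w s) (j.eval w s)
  | alpha => I.alpha
  | oneAddEps => I.oneAddEps

/-- Programs. -/
inductive Cmd where
  /-- `x := e` -/
  | assign (x : ℕ) (e : Expr)
  /-- `a[i] := e` -/
  | write (a : ℕ) (i e : Expr)
  /-- `x :=` a uniformly random element of `{0, …, e - 1}` (and `x := 0` if `e = 0`) -/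
  | rand (x : ℕ) (e : Expr)
  /-- real register `r :=` an input number -/
  | realLoad (r : ℕ) (v : RealRef)
  /-- real register `r :=` real register `q` -/
  | realCopy (r q : ℕ)
  /-- multiply real register `r` by an input number -/
  | realMul (r : ℕ) (v : RealRef)
  /-- divide real register `r` by an input number -/
  | realDiv (r : ℕ) (v : RealRef)
  /-- `x := 1` if real register `r` is less than real register `q`, and `x := 0` otherwise -/
  | realLt (x r q : ℕ)
  /-- first `c`, then `d` -/
  | seq (c d : Cmd)
  /-- `c` if the value of `e` is nonzero, and `d` otherwise -/
  | ite (e : Expr) (c d : Cmd)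
  /-- repeat `c` while the value of `e` is nonzero -/
  | loop (e : Expr) (c : Cmd)

/-- Deterministic programs on words: no random choices and no real registers. -/
def Cmd.IsWordProgram : Cmd → Prop
  | assign _ _ => True
  | write _ _ _ => True
  | seq c d => c.IsWordProgram ∧ d.IsWordProgram
  | ite _ c d => c.IsWordProgram ∧ d.IsWordProgram
  | loop _ c => c.IsWordProgram
  | _ => False

/-- The uniform distribution on `{0, …, k - 1}`, and the point mass at `0` if `k = 0`. -/
noncomputable def uniformBelow (k : ℕ) : PMF ℕ :=
  if h : (Finset.range k).Nonempty then PMF.uniformOfFinset (Finset.range k) h else PMF.pure 0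

/-- A configuration: the commands still to be executed, and the memory. The machine has halted
when no command is left. -/
abbrev Config := List Cmd × State

/-- One step of the machine with words of `w` bits and real input `I`.  Every elementary command
and every test takes one step; the expressions of a program have a fixed size, so this is the
usual unit cost up to a constant factor that depends on the program only. -/
noncomputable def step (w : ℕ) (I : RealInput) : Config → PMF Config
  | ([], s) => PMF.pure ([], s)
  | (Cmd.assign x e :: K, s) => PMF.pure (K, s.setVar x (e.eval w s))
  | (Cmd.write a i e :: K, s) => PMF.pure (K, s.setArr a (i.eval w s) (e.eval w s))
  | (Cmd.rand x e :: K, s) => (uniformBelow (e.eval w s)).map fun v => (K, s.setVar x v)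
  | (Cmd.realLoad r v :: K, s) => PMF.pure (K, s.setReal r (v.eval w I s))
  | (Cmd.realCopy r q :: K, s) => PMF.pure (K, s.setReal r (s.real q))
  | (Cmd.realMul r v :: K, s) => PMF.pure (K, s.setReal r (s.real r * v.eval w I s))
  | (Cmd.realDiv r v :: K, s) => PMF.pure (K, s.setReal r (s.real r / v.eval w I s))
  | (Cmd.realLt x r q :: K, s) => PMF.pure (K, s.setVar x (if s.real r < s.real q then 1 else 0))
  | (Cmd.seq c d :: K, s) => PMF.pure (c :: d :: K, s)
  | (Cmd.ite e c d :: K, s) => PMF.pure (if e.eval w s ≠ 0 then c :: K else d :: K, s)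
  | (Cmd.loop e c :: K, s) => PMF.pure (if e.eval w s ≠ 0 then c :: Cmd.loop e c :: K else K, s)

/-- The distribution of the configuration after `t` steps. -/
noncomputable def runFor (w : ℕ) (I : RealInput) : ℕ → Config → PMF Config
  | 0, c => PMF.pure c
  | t + 1, c => (step w I c).bind (runFor w I t)

/-! ### Exponents of matrix multiplication -/

/-- `ω` is a feasible exponent for the multiplication of Boolean matrices: some deterministic word
program multiplies `n × n` Boolean matrices in `Õ(n ^ ω)` steps on words of `O(log n)` bits.
The number `n` is given in variable `0` and the matrices row by row in the arrays `0` and `1`, the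
product is returned in array `2`, and the rest of the memory is uninitialized. -/
def IsMatMulExponent (ω : ℝ) : Prop :=
  ∃ prog : Cmd, prog.IsWordProgram ∧ ∃ (C : ℝ) (k K : ℕ),
    ∀ n : ℕ, 2 ≤ n → ∀ w : ℕ, n ^ K ≤ 2 ^ w →
    ∀ (I : RealInput) (A B : Matrix (Fin n) (Fin n) Bool) (s : State), s.Valid w →
      s.var 0 = n →
      (∀ i j : Fin n, s.arr 0 (i * n + j) = (A i j).toNat) →
      (∀ i j : Fin n, s.arr 1 (i * n + j) = (B i j).toNat) →
      ∃ T : ℕ, (T : ℝ) ≤ C * (n : ℝ) ^ ω * Real.log n ^ k ∧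
        ∀ c ∈ (runFor w I T ([prog], s)).support, c.1 = [] ∧
          ∀ i j : Fin n, c.2.arr 2 (i * n + j) = if ∃ l, A i l = true ∧ B l j = true then 1 else 0

/-! ### Metric spaces as inputs, graphs as outputs -/

/-- The input for the metric space `P`, whose points are numbered by `e`, and the parameters
`α` and `ε`. -/
noncomputable def metricInput {P : Type*} [MetricSpace P] {n : ℕ} (e : Fin n ≃ P) (α ε : ℝ) :
    RealInput where
  dist i j := if h : i < n ∧ j < n then dist (e ⟨i, h.1⟩) (e ⟨j, h.2⟩) else 0
  alpha := α
  oneAddEps := 1 + ε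

/-- The graph whose adjacency matrix is stored, row by row, in array `0`. -/
def outputGraph {P : Type*} {n : ℕ} (e : Fin n ≃ P) (s : State) : Digraph P where
  Adj p q := s.arr 0 ((e.symm p : ℕ) * n + (e.symm q : ℕ)) ≠ 0

end SparseNav

namespace SparseNav

/-! ### A cost logic for deterministic runs -/

/-! The algorithm is greedy, scale by scale. For $r=d_{\min}(1+\varepsilon)^k$ consider the ordered
pairs $(i,j)$ with $r\le d(i,j)<r(1+\varepsilon)$. Such a pair counts as covered once there is an
edge $(i,u)$ with $d(u,j)<r/\alpha$; as $r\le d(i,j)$, this suffices for $\alpha$-navigability. The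
columns $j$ are visited in order, and $(i,j)$ becomes an edge exactly if it is still uncovered when
column $j$ is reached. A new edge covers its own pair.

Sparsity: let $\beta=2\alpha(1+\varepsilon)$ and suppose that one point $u$ satisfies
$d(u,j)<d(i,j)/\beta$ and $d(u,j')<d(i,j')/\beta$ for two edges $(i,j),(i,j')$. If $r$ is the larger
of their scales, then $u$ is within $r/(2\alpha)$ of both $j$ and $j'$, so $d(j,j')<r/\alpha$ and
the edge chosen first would have covered the other pair (`RealInput.IsMetric.dist_lt`,
`IsGreedy.scaleGraph`). Hence in a $\beta$-navigable graph the edges serving distinct greedy edges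
out of $i$ are distinct, and the greedy graph has at most as many edges out of every vertex
(`isBicriteriaApprox_of_separated`). The approximation factor is really $1$, the program draws no
random numbers, and it succeeds with probability $1$.

Running time: coverage is a Boolean product of the edge matrix with the matrix of near pairs, but an
online one, as column $j$ depends on the edges into earlier columns. With $T=t+1$ and $b$ the
largest power of two dividing $T$, only the block of columns $[T-b,T+b)$ is updated after column
$t$. For all $u<j$ some $T\in(u,j]$ has both $u$ and $j$ in its block (`exists_lowbit_block`), so
every edge is taken into account in time. An update with $m=2b$ needs about $n/m$ products of
$m\times m$ matrices, each of cost at most $Dm^2$ with $D=\widetilde O(n^{\omega-2})$. Since the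
numbers $b$ sum to $O(n\log n)$ (`sum_lowbit_le`), a scale costs $\widetilde O(n^\omega)$, and there
are $O(1+\log\Delta/\varepsilon)$ scales (`exists_scale_count`). The uniform bound $D$ uses
$\omega\ge2$, which holds because a product has $n^2$ output cells to write (`sq_le_of_matMul`,
`two_le_of_sq_le`). -/

theorem State.setVar_var (s : State) (x v y : ℕ) :
    (s.setVar x v).var y = if y = x then v else s.var y := by
  simp [State.setVar, Function.update_apply]

theorem State.setVar_arr (s : State) (x v : ℕ) : (s.setVar x v).arr = s.arr := rfl

theorem State.setVar_real (s : State) (x v : ℕ) : (s.setVar x v).real = s.real := rfl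

theorem State.setArr_var (s : State) (a i v : ℕ) : (s.setArr a i v).var = s.var := rfl

theorem State.setArr_arr (s : State) (a i v b j : ℕ) :
    (s.setArr a i v).arr b j = if b = a ∧ j = i then v else s.arr b j := by
  by_cases h : b = a
  · subst h; simp [State.setArr, Function.update_apply]
  · simp [State.setArr, h]

theorem State.setArr_real (s : State) (a i v : ℕ) : (s.setArr a i v).real = s.real := rfl

theorem State.setReal_var (s : State) (r : ℕ) (v : ℝ) : (s.setReal r v).var = s.var := rfl

theorem State.setReal_arr (s : State) (r : ℕ) (v : ℝ) : (s.setReal r v).arr = s.arr := rfl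

theorem State.setReal_real (s : State) (r : ℕ) (v : ℝ) (q : ℕ) :
    (s.setReal r v).real q = if q = r then v else s.real q := by
  simp [State.setReal, Function.update_apply]

theorem Expr.eval_lt {w : ℕ} (hw : 1 ≤ w) {s : State} (hs : s.Valid w) (e : Expr) :
    e.eval w s < 2 ^ w := by
  have h2 : 1 < 2 ^ w := Nat.one_lt_two_pow (by omega)
  induction e with
  | const c => exact Nat.mod_lt _ (by omega)
  | var x => exact hs.1 x
  | read a i => exact hs.2 a _
  | add e f => exact Nat.mod_lt _ (by omega)
  | sub e f he => exact lt_of_le_of_lt (Nat.sub_le _ _) he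
  | mul e f => exact Nat.mod_lt _ (by omega)
  | div e f he => exact lt_of_le_of_lt (Nat.div_le_self _ _) he
  | mod e f he => exact lt_of_le_of_lt (Nat.mod_le _ _) he
  | lt e f => simp only [Expr.eval]; split_ifs <;> omega
  | eq e f => simp only [Expr.eval]; split_ifs <;> omega

theorem State.Valid.setVar {w : ℕ} {s : State} (hs : s.Valid w) (x : ℕ) {v : ℕ}
    (hv : v < 2 ^ w) : (s.setVar x v).Valid w := by
  refine ⟨fun y => ?_, hs.2⟩
  rw [State.setVar_var]; split_ifs; exacts [hv, hs.1 y]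

theorem State.Valid.setArr {w : ℕ} {s : State} (hs : s.Valid w) (a i : ℕ) {v : ℕ}
    (hv : v < 2 ^ w) : (s.setArr a i v).Valid w := by
  refine ⟨hs.1, fun b j => ?_⟩
  rw [State.setArr_arr]; split_ifs; exacts [hv, hs.2 b j]

/-- The command assigns to the word variable `y`. -/
def Cmd.WritesVar (y : ℕ) : Cmd → Prop
  | assign x _ => x = y
  | rand x _ => x = y
  | realLt x _ _ => x = y
  | seq c d => c.WritesVar y ∨ d.WritesVar y
  | ite _ c d => c.WritesVar y ∨ d.WritesVar y
  | loop _ c => c.WritesVar y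
  | _ => False

/-- The command writes to the array `b`. -/
def Cmd.WritesArr (b : ℕ) : Cmd → Prop
  | write a _ _ => a = b
  | seq c d => c.WritesArr b ∨ d.WritesArr b
  | ite _ c d => c.WritesArr b ∨ d.WritesArr b
  | loop _ c => c.WritesArr b
  | _ => False

/-- The command writes to the real register `q`. -/
def Cmd.WritesReal (q : ℕ) : Cmd → Prop
  | realLoad r _ => r = q
  | realCopy r _ => r = q
  | realMul r _ => r = q
  | realDiv r _ => r = q
  | seq c d => c.WritesReal q ∨ d.WritesReal q
  | ite _ c d => c.WritesReal q ∨ d.WritesReal q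
  | loop _ c => c.WritesReal q
  | _ => False

/-- The states agree on all that the command does not write to. -/
structure Agree (c : Cmd) (s s' : State) : Prop where
  var : ∀ y, ¬ c.WritesVar y → s'.var y = s.var y
  arr : ∀ b, ¬ c.WritesArr b → s'.arr b = s.arr b
  real : ∀ q, ¬ c.WritesReal q → s'.real q = s.real q

theorem Agree.refl (c : Cmd) (s : State) : Agree c s s := ⟨by simp, by simp, by simp⟩

theorem Agree.trans {c : Cmd} {s s' s'' : State} (h : Agree c s s') (h' : Agree c s' s'') :
    Agree c s s'' :=
  ⟨fun y hy => (h'.var y hy).trans (h.var y hy), fun y hy => (h'.arr y hy).trans (h.arr y hy),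
    fun y hy => (h'.real y hy).trans (h.real y hy)⟩

theorem Agree.mono {c d : Cmd} {s s' : State} (h : Agree c s s')
    (hv : ∀ y, c.WritesVar y → d.WritesVar y) (ha : ∀ y, c.WritesArr y → d.WritesArr y)
    (hr : ∀ y, c.WritesReal y → d.WritesReal y) : Agree d s s' :=
  ⟨fun y hy => h.var y (mt (hv y) hy), fun y hy => h.arr y (mt (ha y) hy),
    fun y hy => h.real y (mt (hr y) hy)⟩

/-- The frame facts concern the whole list of pending commands, because a step may unfold a compound
command into several. Speaking of the support covers random draws as well. -/
theorem step_support {w : ℕ} (hw : 1 ≤ w) {I : RealInput} {L : List Cmd} {s : State}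
    {c : Config} (hc : c ∈ (step w I (L, s)).support) :
    (s.Valid w → c.2.Valid w) ∧
    (∀ y, (∀ d ∈ L, ¬ d.WritesVar y) → (∀ d ∈ c.1, ¬ d.WritesVar y) ∧ c.2.var y = s.var y) ∧
    (∀ y, (∀ d ∈ L, ¬ d.WritesArr y) → (∀ d ∈ c.1, ¬ d.WritesArr y) ∧ c.2.arr y = s.arr y) ∧
    (∀ y, (∀ d ∈ L, ¬ d.WritesReal y) →
      (∀ d ∈ c.1, ¬ d.WritesReal y) ∧ c.2.real y = s.real y) := by
  have h2 : 1 < 2 ^ w := Nat.one_lt_two_pow (by omega)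
  rcases L with _ | ⟨a, K⟩
  · simp only [step, PMF.support_pure, Set.mem_singleton_iff] at hc
    subst hc; simp
  · cases a with
    | assign x e =>
      simp only [step, PMF.support_pure, Set.mem_singleton_iff] at hc
      subst hc
      refine ⟨fun hs => hs.setVar _ (e.eval_lt hw hs), ?_, ?_, ?_⟩ <;>
        simp +contextual [Cmd.WritesVar, Cmd.WritesArr, Cmd.WritesReal, State.setVar_var,
          State.setVar_arr, State.setVar_real]
      intro y h _ h'; exact absurd h'.symm h
    | write x i e =>
      simp only [step, PMF.support_pure, Set.mem_singleton_iff] at hc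
      subst hc
      refine ⟨fun hs => hs.setArr _ _ (e.eval_lt hw hs), ?_, ?_, ?_⟩ <;>
        simp +contextual [Cmd.WritesVar, Cmd.WritesArr, Cmd.WritesReal, State.setArr_var,
          State.setArr_real]
      intro y h _; ext j; rw [State.setArr_arr, if_neg]; rintro ⟨rfl, -⟩; exact h rfl
    | rand x e =>
      simp only [step, PMF.support_map, Set.mem_image] at hc
      obtain ⟨v, hv, rfl⟩ := hc
      refine ⟨fun hs => hs.setVar _ ?_, ?_, ?_, ?_⟩
      · unfold uniformBelow at hv
        split_ifs at hv with h
        · rw [PMF.mem_support_uniformOfFinset_iff, Finset.mem_range] at hv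
          exact hv.trans (e.eval_lt hw hs)
        · rw [PMF.support_pure, Set.mem_singleton_iff] at hv; omega
      all_goals
        simp +contextual [Cmd.WritesVar, Cmd.WritesArr, Cmd.WritesReal, State.setVar_var,
          State.setVar_arr, State.setVar_real]
      intro y h _ h'; exact absurd h'.symm h
    | realLoad r v =>
      simp only [step, PMF.support_pure, Set.mem_singleton_iff] at hc
      subst hc
      refine ⟨id, ?_, ?_, ?_⟩ <;>
        simp +contextual [Cmd.WritesVar, Cmd.WritesArr, Cmd.WritesReal, State.setReal_var,
          State.setReal_arr, State.setReal_real]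
      intro y h _ h'; exact absurd h'.symm h
    | realCopy r v =>
      simp only [step, PMF.support_pure, Set.mem_singleton_iff] at hc
      subst hc
      refine ⟨id, ?_, ?_, ?_⟩ <;>
        simp +contextual [Cmd.WritesVar, Cmd.WritesArr, Cmd.WritesReal, State.setReal_var,
          State.setReal_arr, State.setReal_real]
      intro y h _ h'; exact absurd h'.symm h
    | realMul r v =>
      simp only [step, PMF.support_pure, Set.mem_singleton_iff] at hc
      subst hc
      refine ⟨id, ?_, ?_, ?_⟩ <;>
        simp +contextual [Cmd.WritesVar, Cmd.WritesArr, Cmd.WritesReal, State.setReal_var,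
          State.setReal_arr, State.setReal_real]
      intro y h _ h'; exact absurd h'.symm h
    | realDiv r v =>
      simp only [step, PMF.support_pure, Set.mem_singleton_iff] at hc
      subst hc
      refine ⟨id, ?_, ?_, ?_⟩ <;>
        simp +contextual [Cmd.WritesVar, Cmd.WritesArr, Cmd.WritesReal, State.setReal_var,
          State.setReal_arr, State.setReal_real]
      intro y h _ h'; exact absurd h'.symm h
    | realLt x r q =>
      simp only [step, PMF.support_pure, Set.mem_singleton_iff] at hc
      subst hc
      refine ⟨fun hs => hs.setVar _ (by split_ifs <;> omega), ?_, ?_, ?_⟩ <;>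
        simp +contextual [Cmd.WritesVar, Cmd.WritesArr, Cmd.WritesReal, State.setVar_var,
          State.setVar_arr, State.setVar_real]
      intro y h _ h'; exact absurd h'.symm h
    | seq c d =>
      simp only [step, PMF.support_pure, Set.mem_singleton_iff] at hc
      subst hc
      simp +contextual [Cmd.WritesVar, Cmd.WritesArr, Cmd.WritesReal]
    | ite e c d =>
      simp only [step, PMF.support_pure, Set.mem_singleton_iff] at hc
      subst hc
      split_ifs <;> simp +contextual [Cmd.WritesVar, Cmd.WritesArr, Cmd.WritesReal]
    | loop e c =>
      simp only [step, PMF.support_pure, Set.mem_singleton_iff] at hc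
      subst hc
      split_ifs <;> simp +contextual [Cmd.WritesVar, Cmd.WritesArr, Cmd.WritesReal]

theorem runFor_support {w : ℕ} (hw : 1 ≤ w) {I : RealInput} (t : ℕ) {L : List Cmd} {s : State}
    {c : Config} (hc : c ∈ (runFor w I t (L, s)).support) :
    (s.Valid w → c.2.Valid w) ∧
    (∀ y, (∀ d ∈ L, ¬ d.WritesVar y) → c.2.var y = s.var y) ∧
    (∀ y, (∀ d ∈ L, ¬ d.WritesArr y) → c.2.arr y = s.arr y) ∧
    (∀ y, (∀ d ∈ L, ¬ d.WritesReal y) → c.2.real y = s.real y) := by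
  induction t generalizing L s with
  | zero =>
    simp only [runFor, PMF.support_pure, Set.mem_singleton_iff] at hc
    subst hc; simp
  | succ t ih =>
    simp only [runFor, PMF.support_bind, Set.mem_iUnion] at hc
    obtain ⟨⟨L', s'⟩, h1, h2⟩ := hc
    obtain ⟨a1, a2, a3, a4⟩ := step_support hw h1
    obtain ⟨b1, b2, b3, b4⟩ := ih h2
    exact ⟨fun h => b1 (a1 h), fun y h => (b2 y (a2 y h).1).trans (a2 y h).2,
      fun y h => (b3 y (a3 y h).1).trans (a3 y h).2, fun y h => (b4 y (a4 y h).1).trans (a4 y h).2⟩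

theorem runFor_add (w : ℕ) (I : RealInput) (a b : ℕ) (c : Config) :
    runFor w I (a + b) c = (runFor w I a c).bind (runFor w I b) := by
  induction a generalizing c with
  | zero => simp [runFor]
  | succ a ih =>
    rw [show a + 1 + b = (a + b) + 1 by omega, runFor, runFor, PMF.bind_bind]
    congr 1; funext d; exact ih d

/-- Started in the state `s`, the command `c` halts after exactly `t` steps in the state `s'`,
whatever comes after it. -/
def Runs (w : ℕ) (I : RealInput) (c : Cmd) (s : State) (t : ℕ) (s' : State) : Prop :=
  ∀ K, runFor w I t (c :: K, s) = PMF.pure (K, s')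

/-- Started in the state `s`, the command `c` halts within `N` steps in a state with `Q`. -/
def Does (w : ℕ) (I : RealInput) (c : Cmd) (s : State) (N : ℕ) (Q : State → Prop) : Prop :=
  ∃ t ≤ N, ∃ s', Runs w I c s t s' ∧ Q s'

section Rules

variable {w : ℕ} {I : RealInput} {s : State}

theorem Runs.frame (hw : 1 ≤ w) {c : Cmd} {t : ℕ} {s' : State} (h : Runs w I c s t s') :
    (s.Valid w → s'.Valid w) ∧ Agree c s s' := by
  have h0 : (([] : List Cmd), s') ∈ (runFor w I t ([c], s)).support := by rw [h []]; simp
  obtain ⟨a1, a2, a3, a4⟩ := runFor_support hw t h0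
  exact ⟨a1, fun y hy => a2 y (by simpa using hy), fun y hy => a3 y (by simpa using hy),
    fun y hy => a4 y (by simpa using hy)⟩

theorem Does.mono {c : Cmd} {N N' : ℕ} {Q Q' : State → Prop} (h : Does w I c s N Q)
    (hN : N ≤ N') (hQ : ∀ s', Q s' → Q' s') : Does w I c s N' Q' := by
  obtain ⟨t, ht, s', h1, h2⟩ := h
  exact ⟨t, ht.trans hN, s', h1, hQ _ h2⟩

theorem Does.frame (hw : 1 ≤ w) (hs : s.Valid w) {c : Cmd} {N : ℕ} {Q : State → Prop}
    (h : Does w I c s N Q) : Does w I c s N fun s' => s'.Valid w ∧ Agree c s s' ∧ Q s' := by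
  obtain ⟨t, ht, s', h1, h2⟩ := h
  exact ⟨t, ht, s', h1, (h1.frame hw).1 hs, (h1.frame hw).2, h2⟩

theorem runs_of_step {c : Cmd} {s' : State} (h : ∀ K, step w I (c :: K, s) = PMF.pure (K, s')) :
    Runs w I c s 1 s' := by
  intro K
  simp [runFor, h]

theorem does_assign {x : ℕ} {e : Expr} {Q : State → Prop} (h : Q (s.setVar x (e.eval w s))) :
    Does w I (.assign x e) s 1 Q := ⟨1, le_rfl, _, runs_of_step fun _ => rfl, h⟩

theorem does_write {a : ℕ} {i e : Expr} {Q : State → Prop}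
    (h : Q (s.setArr a (i.eval w s) (e.eval w s))) :
    Does w I (.write a i e) s 1 Q := ⟨1, le_rfl, _, runs_of_step fun _ => rfl, h⟩

theorem does_realLoad {r : ℕ} {v : RealRef} {Q : State → Prop}
    (h : Q (s.setReal r (v.eval w I s))) :
    Does w I (.realLoad r v) s 1 Q := ⟨1, le_rfl, _, runs_of_step fun _ => rfl, h⟩

theorem does_realCopy {r q : ℕ} {Q : State → Prop} (h : Q (s.setReal r (s.real q))) :
    Does w I (.realCopy r q) s 1 Q := ⟨1, le_rfl, _, runs_of_step fun _ => rfl, h⟩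

theorem does_realMul {r : ℕ} {v : RealRef} {Q : State → Prop}
    (h : Q (s.setReal r (s.real r * v.eval w I s))) :
    Does w I (.realMul r v) s 1 Q := ⟨1, le_rfl, _, runs_of_step fun _ => rfl, h⟩

theorem does_realDiv {r : ℕ} {v : RealRef} {Q : State → Prop}
    (h : Q (s.setReal r (s.real r / v.eval w I s))) :
    Does w I (.realDiv r v) s 1 Q := ⟨1, le_rfl, _, runs_of_step fun _ => rfl, h⟩

theorem does_realLt {x r q : ℕ} {Q : State → Prop}
    (h : Q (s.setVar x (if s.real r < s.real q then 1 else 0))) :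
    Does w I (.realLt x r q) s 1 Q := ⟨1, le_rfl, _, runs_of_step fun _ => rfl, h⟩

theorem does_seq {c d : Cmd} {a b : ℕ} {Q : State → Prop}
    (h : Does w I c s a fun s' => Does w I d s' b Q) : Does w I (.seq c d) s (a + b + 1) Q := by
  obtain ⟨t, ht, s', h1, t', ht', s'', h2, hQ⟩ := h
  refine ⟨t + t' + 1, by omega, s'', fun K => ?_, hQ⟩
  rw [runFor]
  simp only [step, PMF.pure_bind]
  rw [runFor_add, h1, PMF.pure_bind, h2]

theorem does_ite {e : Expr} {c d : Cmd} {N : ℕ} {Q : State → Prop}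
    (h1 : e.eval w s ≠ 0 → Does w I c s N Q) (h2 : e.eval w s = 0 → Does w I d s N Q) :
    Does w I (.ite e c d) s (N + 1) Q := by
  by_cases h : e.eval w s = 0
  · obtain ⟨t, ht, s', h1, hQ⟩ := h2 h
    refine ⟨t + 1, by omega, s', fun K => ?_, hQ⟩
    rw [runFor]
    simp only [step, PMF.pure_bind, h, ne_eq, not_true_eq_false, if_false]
    exact h1 K
  · obtain ⟨t, ht, s', h1, hQ⟩ := h1 h
    refine ⟨t + 1, by omega, s', fun K => ?_, hQ⟩
    rw [runFor]
    simp only [step, PMF.pure_bind, h, ne_eq, not_false_eq_true, if_true]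
    exact h1 K

/-- The number of rounds is fixed in advance, and the invariant has to decide the test in every
round. Validity and agreement with the initial state are supplied to each round, so invariants need
to mention only what the body changes. -/
theorem does_loop (hw : 1 ≤ w) (hs : s.Valid w) {e : Expr} {c : Cmd} (Inv : ℕ → State → Prop)
    (cost : ℕ → ℕ) (N : ℕ) (h0 : Inv 0 s)
    (hbody : ∀ k < N, ∀ s', s'.Valid w → Agree c s s' → Inv k s' →
      e.eval w s' ≠ 0 ∧ Does w I c s' (cost k) (Inv (k + 1)))
    (hend : ∀ s', s'.Valid w → Agree c s s' → Inv N s' → e.eval w s' = 0) :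
    Does w I (.loop e c) s (∑ k ∈ Finset.range N, (cost k + 1) + 1) (Inv N) := by
  -- Induction on the number `j` of rounds that remain, from any intermediate state.
  suffices H : ∀ j k, k + j = N → ∀ s', s'.Valid w → Agree c s s' → Inv k s' →
      Does w I (.loop e c) s' (∑ i ∈ Finset.Ico k N, (cost i + 1) + 1) (Inv N) by
    have := H N 0 (by simp) s hs (Agree.refl _ _) h0
    rwa [← Finset.range_eq_Ico] at this
  intro j
  induction j with
  | zero =>
    intro k hk s' hs' ha hi
    obtain rfl : k = N := by simpa using hk
    refine ⟨1, by simp, s', fun K => ?_, hi⟩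
    simp [runFor, step, hend s' hs' ha hi]
  | succ j ih =>
    intro k hk s' hs' ha hi
    obtain ⟨he, hd⟩ := hbody k (by omega) s' hs' ha hi
    obtain ⟨t, ht, s1, hr, hi1⟩ := hd
    obtain ⟨hv1, ha1⟩ := hr.frame hw
    obtain ⟨t', ht', s2, hr2, hi2⟩ := ih (k + 1) (by omega) s1 (hv1 hs') (ha.trans ha1) hi1
    refine ⟨t + t' + 1, ?_, s2, fun K => ?_, hi2⟩
    · rw [Finset.sum_eq_sum_Ico_succ_bot (by omega)]; omega
    · rw [runFor]
      simp only [step, PMF.pure_bind, he, ne_eq, not_false_eq_true, if_true]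
      rw [runFor_add, hr, PMF.pure_bind, hr2]

/-- The loop that executes the body for `x = 0, …, e - 1`. -/
def forLt (x : ℕ) (e : Expr) (body : Cmd) : Cmd :=
  .seq (.assign x (.const 0))
    (.loop (.lt (.var x) e) (.seq body (.assign x (.add (.var x) (.const 1)))))

/-- The three extra steps per round are the test, the unfolding of the sequence and the increment.
The body must establish the next invariant for the state after the increment, which matters if the
invariant reads the counter. -/
theorem does_forLt (hw : 1 ≤ w) (hs : s.Valid w) {x : ℕ} {e : Expr} {body : Cmd}
    (Inv : ℕ → State → Prop) (cost : ℕ → ℕ) (N : ℕ) (hN : N < 2 ^ w)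
    (hx : ¬ body.WritesVar x)
    (he : ∀ s', Agree (forLt x e body) s s' → e.eval w s' = N)
    (h0 : Inv 0 (s.setVar x 0))
    (hbody : ∀ k < N, ∀ s', s'.Valid w → Agree (forLt x e body) s s' → s'.var x = k → Inv k s' →
      Does w I body s' (cost k) fun s'' => Inv (k + 1) (s''.setVar x (k + 1))) :
    Does w I (forLt x e body) s (∑ k ∈ Finset.range N, (cost k + 3) + 3) (Inv N) := by
  have h2 : 1 < 2 ^ w := Nat.one_lt_two_pow (by omega)
  have hmono : ∀ s', Agree (.seq body (.assign x (.add (.var x) (.const 1)))) (s.setVar x 0) s' →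
      Agree (forLt x e body) s s' := by
    intro s' h
    refine Agree.trans (s' := s.setVar x 0) ⟨?_, ?_, ?_⟩ (h.mono ?_ ?_ ?_)
    · intro y hy
      simp only [forLt, Cmd.WritesVar] at hy
      rw [State.setVar_var, if_neg]; tauto
    · simp [State.setVar_arr]
    · simp [State.setVar_real]
    all_goals simp only [forLt, Cmd.WritesVar, Cmd.WritesArr, Cmd.WritesReal]; tauto
  have H : Does w I (forLt x e body) s
      (1 + (∑ k ∈ Finset.range N, ((cost k + 1 + 1) + 1) + 1) + 1)
      (fun s' => s'.var x = N ∧ Inv N s') := by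
    refine does_seq (does_assign ?_)
    simp only [Expr.eval, Nat.zero_mod]
    refine does_loop hw (hs.setVar x (by omega)) (fun k s' => s'.var x = k ∧ Inv k s')
      (fun k => cost k + 1 + 1) N ⟨by simp [State.setVar_var], h0⟩ ?_ ?_
    · rintro k hk s' hs' ha ⟨hxk, hi⟩
      refine ⟨by simp [Expr.eval, he s' (hmono s' ha), hxk, hk], ?_⟩
      refine does_seq ?_
      refine ((hbody k hk s' hs' (hmono s' ha) hxk hi).frame hw hs').mono le_rfl ?_
      rintro s'' ⟨_, ha'', hi''⟩
      refine does_assign ?_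
      have : (Expr.add (.var x) (.const 1)).eval w s'' = k + 1 := by
        simp only [Expr.eval]
        rw [ha''.var x hx, hxk, Nat.mod_eq_of_lt h2, Nat.mod_eq_of_lt (by omega)]
      rw [this]
      exact ⟨by simp [State.setVar_var], hi''⟩
    · rintro s' hs' ha ⟨hxk, hi⟩
      simp [Expr.eval, he s' (hmono s' ha), hxk]
  refine H.mono ?_ fun s' h => h.2
  simp only [add_assoc]; norm_num; omega

end Rules

/-! ### Word programs -/

/-- Two features of a step of a word program are recorded: it does not depend on the commands that
come later, and it changes at most one array cell. The cell `(0, 0)` is a dummy where none is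
written. -/
theorem word_step (w : ℕ) (I : RealInput) {L : List Cmd} (hL : ∀ d ∈ L, d.IsWordProgram)
    (hne : L ≠ []) (s : State) :
    ∃ c : Config, step w I (L, s) = PMF.pure c ∧ (∀ d ∈ c.1, d.IsWordProgram) ∧
      (∀ K, step w I (L ++ K, s) = PMF.pure (c.1 ++ K, c.2)) ∧
      ∃ p : ℕ × ℕ, ∀ b j, (b, j) ≠ p → c.2.arr b j = s.arr b j := by
  rcases L with _ | ⟨a, L⟩
  · exact absurd rfl hne
  have ha := hL a (by simp)
  have hL' : ∀ d ∈ L, d.IsWordProgram := fun d hd => hL d (by simp [hd])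
  cases a with
  | assign x e => exact ⟨_, rfl, hL', fun K => rfl, (0, 0), fun b j _ => rfl⟩
  | write a i e =>
    refine ⟨_, rfl, hL', fun K => rfl, (a, i.eval w s), fun b j h => ?_⟩
    rw [State.setArr_arr, if_neg]
    rintro ⟨rfl, rfl⟩; exact h rfl
  | seq c d =>
    refine ⟨_, rfl, ?_, fun K => rfl, (0, 0), fun b j _ => rfl⟩
    simp only [List.mem_cons]
    rintro x (rfl | rfl | hx)
    exacts [ha.1, ha.2, hL' x hx]
  | ite e c d =>
    refine ⟨_, rfl, ?_, fun K => ?_, (0, 0), fun b j _ => rfl⟩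
    · dsimp only
      split_ifs <;> simp only [List.mem_cons] <;> rintro x (rfl | hx)
      exacts [ha.1, hL' x hx, ha.2, hL' x hx]
    · simp only [List.cons_append, step]; split_ifs <;> rfl
  | loop e c =>
    refine ⟨_, rfl, ?_, fun K => ?_, (0, 0), fun b j _ => rfl⟩
    · dsimp only
      split_ifs
      · simp only [List.mem_cons]; rintro x (rfl | rfl | hx)
        exacts [ha, ha, hL' x hx]
      · exact hL'
    · simp only [List.cons_append, step]; split_ifs <;> rfl
  | _ => exact ha.elim

theorem runFor_nil (w : ℕ) (I : RealInput) (t : ℕ) (s : State) :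
    runFor w I t ([], s) = PMF.pure ([], s) := by
  induction t with
  | zero => rfl
  | succ t ih => simp [runFor, step, ih]

/-- A matrix multiplication program is known only to have halted after `T` steps when run alone. As
a subroutine it hands over to its continuation at its actual halting time `t`, which exists since
the run is a single path. The set `F` collects the cells written, at most one per step. -/
theorem word_run (w : ℕ) (I : RealInput) (T : ℕ) {L : List Cmd}
    (hL : ∀ d ∈ L, d.IsWordProgram) (s : State)
    (hT : ∀ c ∈ (runFor w I T (L, s)).support, c.1 = []) :
    ∃ t ≤ T, ∃ s', (∀ K, runFor w I t (L ++ K, s) = PMF.pure (K, s')) ∧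
      runFor w I T (L, s) = PMF.pure ([], s') ∧
      ∃ F : Finset (ℕ × ℕ), F.card ≤ t ∧ ∀ b j, (b, j) ∉ F → s'.arr b j = s.arr b j := by
  classical
  induction T generalizing L s with
  | zero =>
    have : L = [] := by simpa [runFor] using hT
    subst this
    exact ⟨0, le_rfl, s, fun K => rfl, rfl, ∅, by simp, by simp⟩
  | succ T ih =>
    by_cases hne : L = []
    · subst hne
      exact ⟨0, by omega, s, fun K => rfl, runFor_nil _ _ _ _, ∅, by simp, by simp⟩
    obtain ⟨⟨L', s1⟩, h1, h2, h3, p, hp⟩ := word_step w I hL hne s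
    have h4 : runFor w I (T + 1) (L, s) = runFor w I T (L', s1) := by
      rw [runFor, h1, PMF.pure_bind]
    rw [h4] at hT
    obtain ⟨t, ht, s', a1, a2, F, hF, hF'⟩ := ih h2 s1 hT
    refine ⟨t + 1, by omega, s', fun K => ?_, h4.trans a2, insert p F,
      (Finset.card_insert_le _ _).trans (by omega), fun b j hb => ?_⟩
    · rw [runFor, h3, PMF.pure_bind]; exact a1 K
    · rw [Finset.mem_insert, not_or] at hb
      exact (hF' b j hb.2).trans (hp b j hb.1)

theorem Cmd.exists_writes_lt (c : Cmd) :
    ∃ B, ∀ y, B ≤ y → ¬ c.WritesVar y ∧ ¬ c.WritesArr y := by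
  induction c with
  | assign x e => exact ⟨x + 1, fun y hy => ⟨by simp only [WritesVar]; omega, by simp [WritesArr]⟩⟩
  | write a i e => exact ⟨a + 1, fun y hy => ⟨by simp [WritesVar], by simp only [WritesArr]; omega⟩⟩
  | rand x e => exact ⟨x + 1, fun y hy => ⟨by simp only [WritesVar]; omega, by simp [WritesArr]⟩⟩
  | realLt x e => exact ⟨x + 1, fun y hy => ⟨by simp only [WritesVar]; omega, by simp [WritesArr]⟩⟩
  | seq c d hc hd =>
    obtain ⟨a, ha⟩ := hc
    obtain ⟨b, hb⟩ := hd
    refine ⟨max a b, fun y hy => ?_⟩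
    have := ha y (by omega)
    have := hb y (by omega)
    simp only [WritesVar, WritesArr]; tauto
  | ite e c d hc hd =>
    obtain ⟨a, ha⟩ := hc
    obtain ⟨b, hb⟩ := hd
    refine ⟨max a b, fun y hy => ?_⟩
    have := ha y (by omega)
    have := hb y (by omega)
    simp only [WritesVar, WritesArr]; tauto
  | loop e c hc => exact hc
  | _ => exact ⟨0, fun y _ => by simp [WritesVar, WritesArr]⟩

theorem Cmd.IsWordProgram.not_writesReal {c : Cmd} (h : c.IsWordProgram) (r : ℕ) :
    ¬ c.WritesReal r := by
  induction c with
  | seq c d hc hd => simp only [WritesReal, not_or]; exact ⟨hc h.1, hd h.2⟩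
  | ite e c d hc hd => simp only [WritesReal, not_or]; exact ⟨hc h.1, hd h.2⟩
  | loop e c hc => exact hc h
  | assign | write => simp [WritesReal]
  | _ => exact h.elim

/-- The function `f` lists the `n × n` matrix of the truth values of `R` row by row. -/
def Rep (f : ℕ → ℕ) (n : ℕ) (R : ℕ → ℕ → Prop) : Prop :=
  ∀ q < n * n, f q = 0 ∧ ¬ R (q / n) (q % n) ∨ f q = 1 ∧ R (q / n) (q % n)

/-- The program `mm` multiplies `n × n` Boolean matrices within `M` steps on words of `w` bits. -/
def Multiplies (mm : Cmd) (w : ℕ) (I : RealInput) (n M : ℕ) : Prop :=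
  ∀ (A B : ℕ → ℕ → Prop) (s : State), s.Valid w → s.var 0 = n →
    Rep (s.arr 0) n A → Rep (s.arr 1) n B →
    Does w I mm s M fun s' =>
      ∀ q < n * n, s'.arr 2 q ≠ 0 ↔ ∃ l < n, A (q / n) l ∧ B l (q % n)

theorem mul_add_lt_mul {i j m n : ℕ} (hi : i < m) (hj : j < n) : i * n + j < m * n :=
  calc i * n + j < i * n + n := by omega
    _ = (i + 1) * n := by ring
    _ ≤ m * n := Nat.mul_le_mul_right _ hi

theorem mul_add_div' {i j n : ℕ} (hj : j < n) : (i * n + j) / n = i := by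
  rw [mul_comm, Nat.mul_add_div (by omega), Nat.div_eq_of_lt hj, add_zero]

theorem mul_add_mod' {i j n : ℕ} (hj : j < n) : (i * n + j) % n = j := by
  rw [mul_comm, Nat.mul_add_mod, Nat.mod_eq_of_lt hj]

theorem multiplies_of_matMul {mm : Cmd} (hmm : mm.IsWordProgram) {ω C : ℝ} {k K : ℕ}
    (H : ∀ n : ℕ, 2 ≤ n → ∀ w : ℕ, n ^ K ≤ 2 ^ w →
    ∀ (I : RealInput) (A B : Matrix (Fin n) (Fin n) Bool) (s : State), s.Valid w →
      s.var 0 = n →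
      (∀ i j : Fin n, s.arr 0 (i * n + j) = (A i j).toNat) →
      (∀ i j : Fin n, s.arr 1 (i * n + j) = (B i j).toNat) →
      ∃ T : ℕ, (T : ℝ) ≤ C * (n : ℝ) ^ ω * Real.log n ^ k ∧
        ∀ c ∈ (runFor w I T ([mm], s)).support, c.1 = [] ∧
          ∀ i j : Fin n, c.2.arr 2 (i * n + j) = if ∃ l, A i l = true ∧ B l j = true then 1 else 0)
    {n : ℕ} (hn : 2 ≤ n) {w : ℕ} (hw : n ^ K ≤ 2 ^ w) (I : RealInput) :
    Multiplies mm w I n ⌊C * (n : ℝ) ^ ω * Real.log n ^ k⌋₊ := by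
  classical
  intro A B s hs h0 hA hB
  have hA2 : ∀ i j : Fin n, s.arr 0 (i * n + j) = (decide (A i j)).toNat := by
    intro i j
    rcases hA (i * n + j) (mul_add_lt_mul i.2 j.2) with h | h <;>
    · rw [mul_add_div' j.2, mul_add_mod' j.2] at h; simp [h]
  have hB2 : ∀ i j : Fin n, s.arr 1 (i * n + j) = (decide (B i j)).toNat := by
    intro i j
    rcases hB (i * n + j) (mul_add_lt_mul i.2 j.2) with h | h <;>
    · rw [mul_add_div' j.2, mul_add_mod' j.2] at h; simp [h]
  obtain ⟨T, hT, hT'⟩ := H n hn w hw I (fun i j => decide (A i j)) (fun i j => decide (B i j)) s hs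
    h0 hA2 hB2
  obtain ⟨t, ht, s', a1, a2, -⟩ := word_run w I T (L := [mm]) (by simpa using hmm) s
    fun c hc => (hT' c hc).1
  refine ⟨t, ht.trans (Nat.le_floor hT), s', a1, fun q hq => ?_⟩
  have h := (hT' ([], s') (by rw [a2]; simp)).2
  have hn0 : 0 < n := by omega
  have h1 := h ⟨q / n, Nat.div_lt_of_lt_mul hq⟩ ⟨q % n, Nat.mod_lt _ hn0⟩
  simp only [Nat.div_add_mod', decide_eq_true_eq] at h1
  rw [h1]
  constructor
  · intro h2
    have : ∃ l : Fin n, A (q / n) l ∧ B l (q % n) := by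
      by_contra h3; rw [if_neg h3] at h2; exact h2 rfl
    obtain ⟨l, hl⟩ := this
    exact ⟨l, l.2, hl⟩
  · rintro ⟨l, hl, hl'⟩
    rw [if_pos ⟨⟨l, hl⟩, hl'⟩]; exact one_ne_zero

/-- An adversary argument: if array `2` initially holds the value `2` everywhere, which no product
has as an entry, then all `n * n` output cells must be overwritten, and a step writes at most one.
-/
theorem sq_le_of_matMul {mm : Cmd} (hmm : mm.IsWordProgram) {ω C : ℝ} {k K : ℕ}
    (H : ∀ n : ℕ, 2 ≤ n → ∀ w : ℕ, n ^ K ≤ 2 ^ w →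
    ∀ (I : RealInput) (A B : Matrix (Fin n) (Fin n) Bool) (s : State), s.Valid w →
      s.var 0 = n →
      (∀ i j : Fin n, s.arr 0 (i * n + j) = (A i j).toNat) →
      (∀ i j : Fin n, s.arr 1 (i * n + j) = (B i j).toNat) →
      ∃ T : ℕ, (T : ℝ) ≤ C * (n : ℝ) ^ ω * Real.log n ^ k ∧
        ∀ c ∈ (runFor w I T ([mm], s)).support, c.1 = [] ∧
          ∀ i j : Fin n, c.2.arr 2 (i * n + j) = if ∃ l, A i l = true ∧ B l j = true then 1 else 0)
    {n : ℕ} (hn : 2 ≤ n) : (n : ℝ) ^ 2 ≤ C * (n : ℝ) ^ ω * Real.log n ^ k := by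
  set w := n ^ K + n + 2 with hw
  have hlt : ∀ a, a ≤ w → a < 2 ^ w := fun a ha => lt_of_le_of_lt ha Nat.lt_two_pow_self
  -- Both factors are zero, and array `2` is filled with the impossible value `2`.
  let s : State := ⟨fun x => if x = 0 then n else 0, fun a _ => if a = 2 then 2 else 0, fun _ => 0⟩
  have hs : s.Valid w := by
    refine ⟨fun x => hlt _ ?_, fun a i => hlt _ ?_⟩
    · change (if x = 0 then n else 0) ≤ w
      split_ifs <;> omega
    · change (if a = 2 then 2 else 0) ≤ w
      split_ifs <;> omega
  obtain ⟨T, hT, hT'⟩ := H n hn w (hlt _ (by omega)).le ⟨fun _ _ => 0, 0, 0⟩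
    (fun _ _ => false) (fun _ _ => false) s hs rfl (fun _ _ => rfl) (fun _ _ => rfl)
  refine le_trans ?_ hT
  obtain ⟨t, ht, s', -, a2, F, hF, hF'⟩ := word_run w _ T (L := [mm]) (by simpa using hmm) s
      fun c hc => (hT' c hc).1
  have h := (hT' ([], s') (by rw [a2]; simp)).2
  have hsub : (Finset.range (n * n)).image (fun q => (2, q)) ⊆ F := by
    intro p hp
    obtain ⟨q, hq, rfl⟩ := Finset.mem_image.1 hp
    rw [Finset.mem_range] at hq
    by_contra hc
    have h1 := hF' _ _ hc
    have h2 := h ⟨q / n, Nat.div_lt_of_lt_mul hq⟩ ⟨q % n, Nat.mod_lt _ (by omega)⟩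
    simp only [Nat.div_add_mod', Bool.false_eq_true, false_and, exists_false, if_false] at h2
    rw [h2] at h1
    exact absurd h1 (by decide : ¬ ((0 : ℕ) = if 2 = 2 then 2 else 0))
  have hc := Finset.card_le_card hsub
  rw [Finset.card_image_of_injective _ (fun a b h => (Prod.mk.inj h).2), Finset.card_range] at hc
  have : n ^ 2 ≤ T := by rw [pow_two]; omega
  exact_mod_cast this

/-- For `ω < 2` the power of the logarithm would be negligible against $n^{2-\omega}$. -/
theorem two_le_of_sq_le {ω C : ℝ} {k : ℕ}
    (H : ∀ n : ℕ, 2 ≤ n → (n : ℝ) ^ 2 ≤ C * (n : ℝ) ^ ω * Real.log n ^ k) : 2 ≤ ω := by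
  by_contra! hω
  have hl := (isLittleO_log_rpow_rpow_atTop (k : ℝ) (s := 2 - ω) (by linarith)).comp_tendsto
    tendsto_natCast_atTop_atTop
  have hc : 0 < 1 / (|C| + 1) := by positivity
  obtain ⟨n, hn, hn2⟩ := ((hl.def hc).and (Filter.eventually_ge_atTop 2)).exists
  have hn0 : (0 : ℝ) < n := by exact_mod_cast (by omega : 0 < n)
  have hlog : 0 ≤ Real.log n := Real.log_natCast_nonneg n
  have hp : 0 < (n : ℝ) ^ (2 - ω) := Real.rpow_pos_of_pos hn0 _
  simp only [Function.comp, Real.rpow_natCast, Real.norm_eq_abs, abs_of_pos hp,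
    abs_of_nonneg (pow_nonneg hlog k)] at hn
  have h1 := H n hn2
  have h2 : (n : ℝ) ^ 2 = (n : ℝ) ^ ω * (n : ℝ) ^ (2 - ω) := by
    rw [← Real.rpow_add hn0, ← Real.rpow_natCast]; congr 1; push_cast; ring
  have hq : 0 < (n : ℝ) ^ ω := Real.rpow_pos_of_pos hn0 _
  rw [h2, mul_comm C, mul_assoc, mul_le_mul_iff_right₀ hq] at h1
  have h3 : C * Real.log n ^ k ≤ |C| * (1 / (|C| + 1) * (n : ℝ) ^ (2 - ω)) :=
    (mul_le_mul_of_nonneg_right (le_abs_self C) (by positivity)).trans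
      (mul_le_mul_of_nonneg_left hn (abs_nonneg C))
  have h4 : |C| * (1 / (|C| + 1) * (n : ℝ) ^ (2 - ω)) =
      (n : ℝ) ^ (2 - ω) - 1 / (|C| + 1) * (n : ℝ) ^ (2 - ω) := by
    field_simp; ring
  have : 0 < 1 / (|C| + 1) * (n : ℝ) ^ (2 - ω) := by positivity
  linarith

/-! ### The program -/

theorem Rep.eq_of {f : ℕ → ℕ} {n : ℕ} {R : ℕ → ℕ → Prop} (h : Rep f n R) {i j : ℕ} (hi : i < n)
    (hj : j < n) : f (i * n + j) = 0 ∧ ¬ R i j ∨ f (i * n + j) = 1 ∧ R i j := by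
  have := h _ (mul_add_lt_mul hi hj)
  rwa [mul_add_div' hj, mul_add_mod' hj] at this

namespace Prog

variable (B : ℕ) (mm : Cmd)

/-- Prepares the product of the block of the graph whose rows start at `B + 6` and whose columns
start at `B + 7`, and of the diagonal block, starting at `B + 7`, of the matrix of the pairs at
distance less than real register `2`. -/
def fillBlock : Cmd :=
  forLt (B + 2) (.mul (.var (B + 5)) (.var (B + 5))) <|
    .seq (.assign (B + 8) (.add (.var (B + 6)) (.div (.var (B + 2)) (.var (B + 5))))) <|
    .seq (.assign (B + 9) (.add (.var (B + 7)) (.mod (.var (B + 2)) (.var (B + 5))))) <|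
    .seq (.assign (B + 10) (.add (.var (B + 7)) (.div (.var (B + 2)) (.var (B + 5))))) <|
    .seq (.write 0 (.var (B + 2))
      (.mul (.mul (.lt (.var (B + 8)) (.var (B + 1))) (.lt (.var (B + 9)) (.var (B + 1))))
        (.read (B + 3) (.add (.mul (.var (B + 8)) (.var (B + 1))) (.var (B + 9)))))) <|
    .seq (.realLoad 3 (.dist (.var (B + 10)) (.var (B + 9)))) <|
    .seq (.realLt (B + 3) 3 2) <|
    .write 1 (.var (B + 2))
      (.mul (.mul (.lt (.var (B + 10)) (.var (B + 1))) (.lt (.var (B + 9)) (.var (B + 1))))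
        (.var (B + 3)))

/-- Removes the pairs found by the product from the uncovered ones. -/
def applyBlock : Cmd :=
  forLt (B + 2) (.mul (.var (B + 5)) (.var (B + 5))) <|
    .seq (.assign (B + 8) (.add (.var (B + 6)) (.div (.var (B + 2)) (.var (B + 5))))) <|
    .seq (.assign (B + 9) (.add (.var (B + 7)) (.mod (.var (B + 2)) (.var (B + 5))))) <|
    .ite (.mul (.mul (.lt (.var (B + 8)) (.var (B + 1))) (.lt (.var (B + 9)) (.var (B + 1))))
        (.read 2 (.var (B + 2))))
      (.write (B + 4) (.add (.mul (.var (B + 8)) (.var (B + 1))) (.var (B + 9))) (.const 0))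
      (.assign (B + 3) (.const 0))

/-- Removes from the uncovered pairs of a block those that the edges within it cover. -/
def blockUpdate : Cmd :=
  .seq (fillBlock B) (.seq (.assign 0 (.var (B + 5))) (.seq mm (applyBlock B)))

end Prog

open Prog

/-! ### Preparing and applying the product of two blocks -/

section Verification

variable {w : ℕ} {I : RealInput} {B n : ℕ} {s : State}

/-- A block may stick out of the `n × n` matrix. Neither the stored cells nor the input distances
mean anything there, so each entry is multiplied by the truth values of the index bounds; this pads
with zeros. The bounds on `m`, `a`, `l` keep the relevant indices below `2 ^ w`, so no arithmetic
wraps around. -/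
theorem does_fillBlock (hw : 1 ≤ w) (hW : 16 * (n * n) < 2 ^ w) (hs : s.Valid w)
    {m a l : ℕ} (hn : s.var (B + 1) = n) (hm : s.var (B + 5) = m) (ha : s.var (B + 6) = a)
    (hl : s.var (B + 7) = l) (hm2 : m ≤ 2 * n) (han : a ≤ n) (hln : l ≤ n)
    {G : ℕ → ℕ → Prop} (hG : Rep (s.arr (B + 3)) n G) :
    Does w I (fillBlock B) s (m * m * 16 + 3) fun s' =>
      Rep (s'.arr 0) m (fun i j => a + i < n ∧ l + j < n ∧ G (a + i) (l + j)) ∧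
      Rep (s'.arr 1) m (fun i j => l + i < n ∧ l + j < n ∧
        I.dist (l + i) (l + j) < s.real 2) := by
  have h2 : 1 < 2 ^ w := Nat.one_lt_two_pow (by omega)
  have hnn : n ≤ n * n := Nat.le_mul_self n
  have hmm : m * m ≤ 4 * (n * n) := by nlinarith
  have hmm1 : m ≤ m * m := Nat.le_mul_self m
  refine (does_forLt hw hs
    (fun k s' =>
      (∀ q < k, s'.arr 0 q = 0 ∧ ¬ (a + q / m < n ∧ l + q % m < n ∧ G (a + q / m) (l + q % m)) ∨
        s'.arr 0 q = 1 ∧ (a + q / m < n ∧ l + q % m < n ∧ G (a + q / m) (l + q % m))) ∧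
      (∀ q < k, s'.arr 1 q = 0 ∧ ¬ (l + q / m < n ∧ l + q % m < n ∧
          I.dist (l + q / m) (l + q % m) < s.real 2) ∨
        s'.arr 1 q = 1 ∧ (l + q / m < n ∧ l + q % m < n ∧
          I.dist (l + q / m) (l + q % m) < s.real 2)))
    (fun _ => 13) (m * m) (by omega) ?_ ?_ ?_ ?_).mono ?_ ?_
  · simp [Cmd.WritesVar]
  · intro s' h
    have : s'.var (B + 5) = m := by
      rw [← hm]; exact h.var _ (by simp [forLt, Cmd.WritesVar])
    simp only [Expr.eval, this]
    exact Nat.mod_eq_of_lt (by omega)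
  · simp
  · rintro k hk s' hs' hag hx ⟨hi0, hi1⟩
    have e1 : s'.var (B + 1) = n := by
      rw [← hn]; exact hag.var _ (by simp [forLt, Cmd.WritesVar])
    have e5 : s'.var (B + 5) = m := by
      rw [← hm]; exact hag.var _ (by simp [forLt, Cmd.WritesVar])
    have e6 : s'.var (B + 6) = a := by
      rw [← ha]; exact hag.var _ (by simp [forLt, Cmd.WritesVar])
    have e7 : s'.var (B + 7) = l := by
      rw [← hl]; exact hag.var _ (by simp [forLt, Cmd.WritesVar])
    have e3 : s'.arr (B + 3) = s.arr (B + 3) := hag.arr _ (by simp [forLt, Cmd.WritesArr])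
    have er : s'.real 2 = s.real 2 := hag.real _ (by simp [forLt, Cmd.WritesReal])
    have hm0 : 0 < m := by by_contra h; simp only [not_lt, Nat.le_zero] at h; subst h; simp at hk
    have hq1 : k / m < m := Nat.div_lt_of_lt_mul hk
    have hq2 : k % m < m := Nat.mod_lt _ hm0
    have f1 : (a + k / m) % 2 ^ w = a + k / m := Nat.mod_eq_of_lt (by omega)
    have f2 : (l + k % m) % 2 ^ w = l + k % m := Nat.mod_eq_of_lt (by omega)
    have f3 : (l + k / m) % 2 ^ w = l + k / m := Nat.mod_eq_of_lt (by omega)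
    refine does_seq (does_assign <| does_seq <| does_assign <| does_seq <| does_assign <|
      does_seq <| does_write <| does_seq <| does_realLoad <| does_seq <| does_realLt <|
      does_write ?_)
    simp only [Expr.eval, RealRef.eval, State.setVar_var, State.setVar_arr, State.setVar_real,
      State.setArr_var, State.setArr_arr, State.setArr_real, State.setReal_var, State.setReal_arr,
      State.setReal_real, hx, e1, e5, e6, e7, e3, er]
    simp [f1, f2, f3]
    refine ⟨fun q hq => ?_, fun q hq => ?_⟩
    · rcases hq.eq_or_lt with rfl | hq
      · by_cases c1 : l + q % m < n <;> by_cases c2 : a + q / m < n <;> simp [c1, c2]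
        have c3 := mul_add_lt_mul c2 c1
        rw [Nat.mod_eq_of_lt (by omega : (a + q / m) * n + (l + q % m) < 2 ^ w)]
        rcases hG.eq_of c2 c1 with ⟨g1, g2⟩ | ⟨g1, g2⟩ <;> simp [g1, g2, Nat.mod_eq_of_lt h2]
      · simpa [hq.ne] using hi0 q hq
    · rcases hq.eq_or_lt with rfl | hq
      · by_cases c1 : l + q % m < n <;> by_cases c2 : l + q / m < n <;>
          by_cases c3 : I.dist (l + q / m) (l + q % m) < s.real 2 <;>
          simp [c1, c2, c3, Nat.mod_eq_of_lt h2]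
        simpa using c3
      · simpa [hq.ne] using hi1 q hq
  · simp
  · exact fun _ h => h

theorem does_applyBlock (hw : 1 ≤ w) (hW : 16 * (n * n) < 2 ^ w) (hs : s.Valid w)
    {m a l : ℕ} (hn : s.var (B + 1) = n) (hm : s.var (B + 5) = m) (ha : s.var (B + 6) = a)
    (hl : s.var (B + 7) = l) (hm2 : m ≤ 2 * n) (han : a ≤ n) (hln : l ≤ n) :
    Does w I (applyBlock B) s (m * m * 9 + 3) fun s' =>
      ∀ q, s'.arr (B + 4) q = 0 ∧ (∃ p < m * m, a + p / m < n ∧ l + p % m < n ∧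
          q = (a + p / m) * n + (l + p % m) ∧ s.arr 2 p ≠ 0) ∨
        s'.arr (B + 4) q = s.arr (B + 4) q ∧ ¬ ∃ p < m * m, a + p / m < n ∧ l + p % m < n ∧
          q = (a + p / m) * n + (l + p % m) ∧ s.arr 2 p ≠ 0 := by
  have h2 : 1 < 2 ^ w := Nat.one_lt_two_pow (by omega)
  have hnn : n ≤ n * n := Nat.le_mul_self n
  have hmm : m * m ≤ 4 * (n * n) := by nlinarith
  have hmm1 : m ≤ m * m := Nat.le_mul_self m
  refine (does_forLt hw hs
    (fun k s' => ∀ q, s'.arr (B + 4) q = 0 ∧ (∃ p < k, a + p / m < n ∧ l + p % m < n ∧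
          q = (a + p / m) * n + (l + p % m) ∧ s.arr 2 p ≠ 0) ∨
        s'.arr (B + 4) q = s.arr (B + 4) q ∧ ¬ ∃ p < k, a + p / m < n ∧ l + p % m < n ∧
          q = (a + p / m) * n + (l + p % m) ∧ s.arr 2 p ≠ 0)
    (fun _ => 6) (m * m) (by omega) ?_ ?_ ?_ ?_).mono ?_ ?_
  · simp [Cmd.WritesVar]
  · intro s' h
    have : s'.var (B + 5) = m := by
      rw [← hm]; exact h.var _ (by simp [forLt, Cmd.WritesVar])
    simp only [Expr.eval, this]
    exact Nat.mod_eq_of_lt (by omega)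
  · simp [State.setVar_arr]
  · rintro k hk s' hs' hag hx hi
    have e1 : s'.var (B + 1) = n := by
      rw [← hn]; exact hag.var _ (by simp [forLt, Cmd.WritesVar])
    have e5 : s'.var (B + 5) = m := by
      rw [← hm]; exact hag.var _ (by simp [forLt, Cmd.WritesVar])
    have e6 : s'.var (B + 6) = a := by
      rw [← ha]; exact hag.var _ (by simp [forLt, Cmd.WritesVar])
    have e7 : s'.var (B + 7) = l := by
      rw [← hl]; exact hag.var _ (by simp [forLt, Cmd.WritesVar])
    have e3 : s'.arr 2 = s.arr 2 := hag.arr _ (by simp [forLt, Cmd.WritesArr])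
    have hm0 : 0 < m := by by_contra h; simp only [not_lt, Nat.le_zero] at h; subst h; simp at hk
    have hq1 : k / m < m := Nat.div_lt_of_lt_mul hk
    have hq2 : k % m < m := Nat.mod_lt _ hm0
    have f1 : (a + k / m) % 2 ^ w = a + k / m := Nat.mod_eq_of_lt (by omega)
    have f2 : (l + k % m) % 2 ^ w = l + k % m := Nat.mod_eq_of_lt (by omega)
    -- The flags and the entry of the product are words, and so is their product: the reduction
    -- modulo `2 ^ w` has no effect.
    have f4 : (if l + k % m < n then if a + k / m < n then s.arr 2 k else 0 else 0) % 2 ^ w =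
        if l + k % m < n then if a + k / m < n then s.arr 2 k else 0 else 0 := by
      have := hs.2 2 k
      exact Nat.mod_eq_of_lt (by split_ifs <;> omega)
    have hsplit : ∀ q, (∃ p < k + 1, a + p / m < n ∧ l + p % m < n ∧
          q = (a + p / m) * n + (l + p % m) ∧ s.arr 2 p ≠ 0) ↔
        (∃ p < k, a + p / m < n ∧ l + p % m < n ∧
          q = (a + p / m) * n + (l + p % m) ∧ s.arr 2 p ≠ 0) ∨ (a + k / m < n ∧ l + k % m < n ∧
          q = (a + k / m) * n + (l + k % m) ∧ s.arr 2 k ≠ 0) := by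
      intro q
      constructor
      · rintro ⟨p, hp, h⟩
        rcases (Nat.lt_succ_iff.1 hp).eq_or_lt with rfl | hp
        exacts [.inr h, .inl ⟨p, hp, h⟩]
      · rintro (⟨p, hp, h⟩ | h)
        exacts [⟨p, by omega, h⟩, ⟨k, by omega, h⟩]
    refine does_seq (does_assign <| does_seq <| does_assign <| does_ite (N := 1) (fun he => ?_) fun he => ?_)
    · simp [Expr.eval, State.setVar_var, State.setVar_arr, hx, e1, e5, e6, e7, e3, f1, f2,
        f4] at he
      obtain ⟨c1, c2, c3⟩ := he
      have c4 := mul_add_lt_mul c2 c1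
      have f3 : ((a + k / m) * n + (l + k % m)) % 2 ^ w = (a + k / m) * n + (l + k % m) :=
        Nat.mod_eq_of_lt (by omega)
      refine does_write ?_
      simp only [State.setVar_arr, State.setArr_arr, hsplit]
      simp [Expr.eval, State.setVar_var, hx, e1, e5, e6, e7, f1, f2,
        f3, c1, c2, c3]
      intro q
      by_cases hq : q = (a + k / m) * n + (l + k % m)
      · simp [hq]
      · simpa [hq] using hi q
    · simp [Expr.eval, State.setVar_var, State.setVar_arr, hx, e1, e5, e6, e7, e3, f1, f2,
        f4] at he
      refine does_assign ?_
      simp only [State.setVar_arr, hsplit]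
      intro q
      have : ¬ (a + k / m < n ∧ l + k % m < n ∧
          q = (a + k / m) * n + (l + k % m) ∧ s.arr 2 k ≠ 0) := by
        rintro ⟨c1, c2, -, c3⟩; exact c3 (he c2 c1)
      simpa only [this, or_false] using hi q
  · simp
  · exact fun _ h => h

end Verification

/-- The matrix multiplication program `mm` uses no variable or array from `B` on and no real
register. -/
structure Fresh (B : ℕ) (mm : Cmd) : Prop where
  var : ∀ i, ¬ mm.WritesVar (B + i)
  arr : ∀ i, ¬ mm.WritesArr (B + i)
  real : ∀ r, ¬ mm.WritesReal r

theorem Rep.congr {f : ℕ → ℕ} {n : ℕ} {R S : ℕ → ℕ → Prop} (h : Rep f n R)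
    (hRS : ∀ i < n, ∀ j < n, R i j ↔ S i j) : Rep f n S := by
  intro q hq
  have h1 : q / n < n := Nat.div_lt_of_lt_mul hq
  rw [← hRS _ h1 _ (Nat.mod_lt _ ((Nat.zero_le _).trans_lt h1))]
  exact h q hq

/-- The uncovered pairs that stay after an update with the block `[l, l + m)`. -/
def stayUncovered (n l m : ℕ) (N G U : ℕ → ℕ → Prop) (i j : ℕ) : Prop :=
  U i j ∧ ¬ (l ≤ j ∧ j < l + m ∧ ∃ u, l ≤ u ∧ u < l + m ∧ u < n ∧ G i u ∧ N u j)

/-! ### One block update, and the sweep over the rows for one column -/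

section Verification

variable {w : ℕ} {I : RealInput} {B n : ℕ} {s : State} {mm : Cmd}

theorem does_blockUpdate (hw : 1 ≤ w) (hW : 16 * (n * n) < 2 ^ w) (hs : s.Valid w)
    (hB : Fresh B mm) {m a l M : ℕ} (hM : Multiplies mm w I m M)
    (hn : s.var (B + 1) = n) (hm : s.var (B + 5) = m) (ha : s.var (B + 6) = a)
    (hl : s.var (B + 7) = l) (hm2 : m ≤ 2 * n) (han : a ≤ n) (hln : l ≤ n)
    {G U : ℕ → ℕ → Prop} (hG : Rep (s.arr (B + 3)) n G) (hU : Rep (s.arr (B + 4)) n U) :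
    Does w I (blockUpdate B mm) s (m * m * 25 + M + 10) fun s' =>
      Rep (s'.arr (B + 4)) n fun i j => U i j ∧ ¬ (a ≤ i ∧ i < a + m ∧ l ≤ j ∧ j < l + m ∧
        ∃ u, l ≤ u ∧ u < l + m ∧ u < n ∧ G i u ∧ I.dist u j < s.real 2) := by
  suffices H : Does w I (blockUpdate B mm) s ((m * m * 16 + 3) + (1 + (M + (m * m * 9 + 3) + 1) + 1)
      + 1) fun s' => Rep (s'.arr (B + 4)) n fun i j => U i j ∧ ¬ (a ≤ i ∧ i < a + m ∧ l ≤ j ∧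
        j < l + m ∧ ∃ u, l ≤ u ∧ u < l + m ∧ u < n ∧ G i u ∧ I.dist u j < s.real 2) from
    H.mono (by omega) fun _ h => h
  refine does_seq (((does_fillBlock hw hW hs hn hm ha hl hm2 han hln hG).frame hw hs).mono le_rfl ?_)
  rintro s1 ⟨hs1, ha1, hA, hA'⟩
  have e5 : s1.var (B + 5) = m := by
    rw [ha1.var _ (by simp [fillBlock, forLt, Cmd.WritesVar]), hm]
  refine does_seq (does_assign ?_)
  have hs2 : (s1.setVar 0 ((Expr.var (B + 5)).eval w s1)).Valid w :=
    hs1.setVar _ (Expr.eval_lt hw hs1 _)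
  refine does_seq (((hM _ _ _ hs2 ?_ hA hA').frame hw hs2).mono le_rfl ?_)
  · simp [State.setVar_var, Expr.eval, e5]
  rintro s3 ⟨hs3, ha3, hC⟩
  have hv : ∀ i, i = 1 ∨ i = 5 ∨ i = 6 ∨ i = 7 → s3.var (B + i) = s.var (B + i) := by
    intro i hi
    rw [ha3.var _ (hB.var i), State.setVar_var, if_neg (by omega),
      ha1.var _ (by rcases hi with rfl | rfl | rfl | rfl <;>
        simp [fillBlock, forLt, Cmd.WritesVar])]
  have hU3 : s3.arr (B + 4) = s.arr (B + 4) := by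
    rw [ha3.arr _ (hB.arr 4), State.setVar_arr,
      ha1.arr _ (by simp [fillBlock, forLt, Cmd.WritesArr])]
  refine (does_applyBlock hw hW hs3 ((hv 1 (by simp)).trans hn) ((hv 5 (by simp)).trans hm)
    ((hv 6 (by simp)).trans ha) ((hv 7 (by simp)).trans hl) hm2 han hln).mono le_rfl ?_
  intro s4 h4 q hq
  have hn0 : 0 < n := by by_contra h; simp only [not_lt, Nat.le_zero] at h; subst h; simp at hq
  -- Translation between positions `p` within the block and positions `q` in the full matrix. The
  -- summation index of the product is the offset `u - l` of the intermediate vertex.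
  have hiff : (∃ p < m * m, a + p / m < n ∧ l + p % m < n ∧
      q = (a + p / m) * n + (l + p % m) ∧ s3.arr 2 p ≠ 0) ↔
      (a ≤ q / n ∧ q / n < a + m ∧ l ≤ q % n ∧ q % n < l + m ∧
        ∃ u, l ≤ u ∧ u < l + m ∧ u < n ∧ G (q / n) u ∧ I.dist u (q % n) < s.real 2) := by
    constructor
    · rintro ⟨p, hp, p1, p2, rfl, p4⟩
      have hm0 : 0 < m := by by_contra h; simp only [not_lt, Nat.le_zero] at h; subst h; simp at hp
      have hq1 : p / m < m := Nat.div_lt_of_lt_mul hp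
      have hq2 : p % m < m := Nat.mod_lt _ hm0
      obtain ⟨u, hu, ⟨-, -, g1⟩, ⟨g2, -, g3⟩⟩ := (hC p hp).1 p4
      rw [mul_add_div' p2, mul_add_mod' p2]
      exact ⟨Nat.le_add_right _ _, by omega, Nat.le_add_right _ _, by omega, l + u, by omega, by omega, g2, g1, g3⟩
    · rintro ⟨p1, p2, p3, p4, u, u1, u2, u3, g1, g2⟩
      have hm0 : q % n - l < m := by omega
      have d1 := mul_add_div' (i := q / n - a) hm0
      have d2 := mul_add_mod' (i := q / n - a) hm0
      have hlt : (q / n - a) * m + (q % n - l) < m * m := mul_add_lt_mul (by omega) hm0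
      have hqn : q / n < n := Nat.div_lt_of_lt_mul hq
      have hqn2 : q % n < n := Nat.mod_lt _ hn0
      have r1 : a + (q / n - a) = q / n := by omega
      have r2 : l + (q % n - l) = q % n := by omega
      have r3 : l + (u - l) = u := by omega
      refine ⟨_, hlt, ?_⟩
      rw [hC _ hlt, d1, d2, r1, r2]
      refine ⟨hqn, hqn2, (Nat.div_add_mod' q n).symm, u - l, by omega, ?_, ?_⟩
      · rw [r3]; exact ⟨hqn, u3, g1⟩
      · rw [r3]; exact ⟨u3, hqn2, g2⟩
  rcases h4 q with ⟨c1, c2⟩ | ⟨c1, c2⟩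
  · exact .inl ⟨c1, fun h => h.2 (hiff.1 c2)⟩
  · rw [c1, hU3]
    rw [hiff] at c2
    rcases hU q hq with ⟨d1, d2⟩ | ⟨d1, d2⟩
    · exact .inl ⟨d1, fun h => d2 h.1⟩
    · exact .inr ⟨d1, d2, c2⟩

namespace Prog

/-- Updates all rows of the uncovered pairs in a block of columns. -/
def sweepRows (B : ℕ) (mm : Cmd) : Cmd :=
  .seq (.assign (B + 6) (.const 0)) <|
    .loop (.lt (.var (B + 6)) (.var (B + 1))) <|
      .seq (blockUpdate B mm) (.assign (B + 6) (.add (.var (B + 6)) (.var (B + 5))))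

/-- Adds the edges to the uncovered points of a column. -/
def selectColumn (B : ℕ) : Cmd :=
  forLt (B + 2) (.var (B + 1)) <|
    .ite (.read (B + 4) (.add (.mul (.var (B + 2)) (.var (B + 1))) (.var (B + 4))))
      (.write (B + 3) (.add (.mul (.var (B + 2)) (.var (B + 1))) (.var (B + 4))) (.const 1))
      (.assign (B + 3) (.const 0))

/-- Finds the block around the first column not yet processed. -/
def findBlock (B : ℕ) : Cmd :=
  .seq (.assign (B + 5) (.const 2)) <|
  .seq (.loop (.eq (.mod (.add (.var (B + 4)) (.const 1)) (.var (B + 5))) (.const 0))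
    (.assign (B + 5) (.mul (.var (B + 5)) (.const 2)))) <|
  .assign (B + 7) (.sub (.add (.var (B + 4)) (.const 1)) (.div (.var (B + 5)) (.const 2)))

/-- Processes all columns. -/
def sweepColumns (B : ℕ) (mm : Cmd) : Cmd :=
  forLt (B + 4) (.var (B + 1)) <|
    .seq (selectColumn B) (.seq (findBlock B) (sweepRows B mm))

end Prog

theorem does_sweepRows (hw : 1 ≤ w) (hW : 16 * (n * n) < 2 ^ w) (hs : s.Valid w)
    (hB : Fresh B mm) {m l M : ℕ} (hM : Multiplies mm w I m M) (hm0 : 0 < m)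
    (hn : s.var (B + 1) = n) (hm : s.var (B + 5) = m)
    (hl : s.var (B + 7) = l) (hm2 : m ≤ 2 * n) (hln : l ≤ n)
    {G U : ℕ → ℕ → Prop} (hG : Rep (s.arr (B + 3)) n G) (hU : Rep (s.arr (B + 4)) n U) :
    Does w I (sweepRows B mm) s ((n + m - 1) / m * (m * m * 25 + M + 13) + 3) fun s' =>
      Rep (s'.arr (B + 4)) n (stayUncovered n l m (fun u j => I.dist u j < s.real 2) G U) := by
  have hnn : n ≤ n * n := Nat.le_mul_self n
  have h2 : 1 < 2 ^ w := Nat.one_lt_two_pow (by omega)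
  -- The number of row blocks is $\lceil n/m\rceil$; the last one may be padded.
  set N := (n + m - 1) / m with hN
  have hN1 : ∀ k < N, k * m < n := by
    intro k hk
    have := (Nat.le_div_iff_mul_le hm0).1 (Nat.succ_le_of_lt hk)
    rw [Nat.succ_mul] at this; omega
  have hN2 : n ≤ N * m := by
    have := Nat.lt_mul_of_div_lt (Nat.lt_succ_self ((n + m - 1) / m)) hm0
    rw [← hN, Nat.succ_mul] at this; omega
  suffices H : Does w I (sweepRows B mm) s
      (1 + (∑ k ∈ Finset.range N, (((m * m * 25 + M + 10) + 1 + 1) + 1) + 1) + 1)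
      fun s' => s'.var (B + 6) = N * m ∧ Rep (s'.arr (B + 4)) n fun i j => U i j ∧
        ¬ (i < N * m ∧ l ≤ j ∧ j < l + m ∧
          ∃ u, l ≤ u ∧ u < l + m ∧ u < n ∧ G i u ∧ I.dist u j < s.real 2) by
    refine H.mono ?_ fun s' h => h.2.congr fun i hi j _ => ?_
    · simp only [Finset.sum_const, Finset.card_range, smul_eq_mul]
      rw [show m * m * 25 + M + 10 + 1 + 1 + 1 = m * m * 25 + M + 13 by ring]; omega
    · rw [stayUncovered, and_iff_right (hi.trans_le hN2)]
  refine does_seq (does_assign ?_)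
  simp only [Expr.eval, Nat.zero_mod]
  refine does_loop hw (hs.setVar _ (by omega)) (fun k s' => s'.var (B + 6) = k * m ∧
      Rep (s'.arr (B + 4)) n fun i j => U i j ∧ ¬ (i < k * m ∧ l ≤ j ∧ j < l + m ∧
          ∃ u, l ≤ u ∧ u < l + m ∧ u < n ∧ G i u ∧ I.dist u j < s.real 2))
    (fun _ => m * m * 25 + M + 10 + 1 + 1) N ?_ ?_ ?_
  · refine ⟨by simp [State.setVar_var], ?_⟩
    simpa [State.setVar_arr] using hU
  · rintro k hk s' hs' hag ⟨hk1, hk2⟩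
    have e1 : s'.var (B + 1) = n := by
      rw [hag.var _ (by simp [blockUpdate, fillBlock, applyBlock, forLt, Cmd.WritesVar, hB.var]),
        State.setVar_var, if_neg (by omega), hn]
    have e5 : s'.var (B + 5) = m := by
      rw [hag.var _ (by simp [blockUpdate, fillBlock, applyBlock, forLt, Cmd.WritesVar, hB.var]),
        State.setVar_var, if_neg (by omega), hm]
    have e7 : s'.var (B + 7) = l := by
      rw [hag.var _ (by simp [blockUpdate, fillBlock, applyBlock, forLt, Cmd.WritesVar, hB.var]),
        State.setVar_var, if_neg (by omega), hl]
    have e3 : s'.arr (B + 3) = s.arr (B + 3) :=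
      hag.arr _ (by simp [blockUpdate, fillBlock, applyBlock, forLt, Cmd.WritesArr, hB.arr])
    have er : s'.real 2 = s.real 2 :=
      hag.real _ (by simp [blockUpdate, fillBlock, applyBlock, forLt, Cmd.WritesReal, hB.real])
    have hkm := hN1 k hk
    refine ⟨by simp [Expr.eval, hk1, e1, hkm], does_seq (a := m * m * 25 + M + 10) (b := 1) ?_⟩
    refine ((does_blockUpdate hw hW hs' hB hM e1 e5 hk1 e7 hm2 hkm.le hln (e3 ▸ hG) hk2).frame
      hw hs').mono le_rfl ?_
    rintro s'' ⟨hs'', hag', hU''⟩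
    have e6 : s''.var (B + 6) = k * m := by
      rw [hag'.var _ (by simp [blockUpdate, fillBlock, applyBlock, forLt, Cmd.WritesVar, hB.var]),
        hk1]
    have e5' : s''.var (B + 5) = m := by
      rw [hag'.var _ (by simp [blockUpdate, fillBlock, applyBlock, forLt, Cmd.WritesVar, hB.var]),
        e5]
    refine does_assign ⟨?_, ?_⟩
    · simp only [State.setVar_var, Expr.eval, e6, e5', if_true]
      rw [Nat.mod_eq_of_lt (by omega)]; ring
    · rw [State.setVar_arr]
      refine hU''.congr fun i hi j hj => ?_
      rw [er, add_mul, one_mul, and_assoc, ← not_or]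
      refine and_congr_right fun _ => not_congr ⟨?_, ?_⟩
      · rintro (⟨c1, c2⟩ | ⟨c1, c1', c2⟩)
        exacts [⟨by omega, c2⟩, ⟨c1', c2⟩]
      · rintro ⟨c1, c2⟩
        by_cases c3 : i < k * m
        exacts [.inl ⟨c3, c2⟩, .inr ⟨by omega, c1, c2⟩]
  · rintro s' hs' hag ⟨hk1, hk2⟩
    have e1 : s'.var (B + 1) = n := by
      rw [hag.var _ (by simp [blockUpdate, fillBlock, applyBlock, forLt, Cmd.WritesVar, hB.var]),
        State.setVar_var, if_neg (by omega), hn]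
    simp [Expr.eval, hk1, e1, hN2]

theorem does_selectColumn (hw : 1 ≤ w) (hW : 16 * (n * n) < 2 ^ w) (hs : s.Valid w)
    {t : ℕ} (hn : s.var (B + 1) = n) (ht : s.var (B + 4) = t) (htn : t < n)
    {G U : ℕ → ℕ → Prop} (hG : Rep (s.arr (B + 3)) n G) (hU : Rep (s.arr (B + 4)) n U) :
    Does w I (selectColumn B) s (n * 5 + 3) fun s' =>
      Rep (s'.arr (B + 3)) n fun i j => G i j ∨ j = t ∧ U i t := by
  have hnn : n ≤ n * n := Nat.le_mul_self n
  have h2 : 1 < 2 ^ w := Nat.one_lt_two_pow (by omega)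
  refine (does_forLt hw hs
    (fun k s' => Rep (s'.arr (B + 3)) n fun i j => G i j ∨ i < k ∧ j = t ∧ U i t)
    (fun _ => 2) n (by omega) ?_ ?_ ?_ ?_).mono ?_ ?_
  · simp [Cmd.WritesVar]
  · intro s' h
    rw [← hn]; exact h.var _ (by simp [forLt, Cmd.WritesVar])
  · simpa [State.setVar_arr] using hG
  · rintro k hk s' hs' hag hx hi
    have e1 : s'.var (B + 1) = n := by
      rw [← hn]; exact hag.var _ (by simp [forLt, Cmd.WritesVar])
    have e4 : s'.var (B + 4) = t := by
      rw [← ht]; exact hag.var _ (by simp [forLt, Cmd.WritesVar])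
    have ea : s'.arr (B + 4) = s.arr (B + 4) := hag.arr _ (by simp [forLt, Cmd.WritesArr])
    have hlt := mul_add_lt_mul hk htn
    have f1 : (k * n + t) % 2 ^ w = k * n + t := Nat.mod_eq_of_lt (by omega)
    have hUk := hU.eq_of hk htn
    refine does_ite (fun he => ?_) fun he => ?_
    · simp only [Expr.eval, hx, e1, e4, ea, Nat.mod_add_mod, f1] at he
      refine does_write ?_
      simp only [Expr.eval, hx, e1, e4, Nat.mod_add_mod, f1, Nat.mod_eq_of_lt h2, State.setVar_arr]
      intro q hq
      simp only [State.setArr_arr, true_and]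
      by_cases hqe : q = k * n + t
      · rw [if_pos hqe]; subst hqe
        rw [mul_add_div' htn, mul_add_mod' htn]
        exact .inr ⟨rfl, .inr ⟨by omega, rfl, by tauto⟩⟩
      · rw [if_neg hqe]
        -- Away from the cell `(k, t)`, passing from `k` to `k + 1` does not change the condition.
        have : q / n < k + 1 ∧ q % n = t ↔ q / n < k ∧ q % n = t := by
          refine ⟨fun h => ⟨?_, h.2⟩, fun h => ⟨by omega, h.2⟩⟩
          by_contra hc
          have h3 : q / n = k := by omega
          exact hqe (by rw [← h3, ← h.2, Nat.div_add_mod'])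
        simp only [← and_assoc, this]
        simp only [and_assoc]
        exact hi q hq
    · simp only [Expr.eval, hx, e1, e4, ea, Nat.mod_add_mod, f1] at he
      refine does_assign ?_
      simp only [State.setVar_arr]
      refine hi.congr fun i _ j _ => or_congr_right
        ⟨fun h => ⟨by omega, h.2⟩, fun h => ⟨?_, h.2⟩⟩
      by_contra hc
      have h3 : i = k := by omega
      subst h3
      have := h.2.2
      rcases hUk with h5 | h5
      · exact h5.2 this
      · omega
  · simp
  · exact fun s' h => h.congr fun i hi j _ => by simp [hi]

/-- The largest power of two that divides `t`. -/
def lowbit (t : ℕ) : ℕ := 2 ^ padicValNat 2 t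

theorem lowbit_le {t : ℕ} (ht : t ≠ 0) : lowbit t ≤ t :=
  Nat.le_of_dvd (Nat.pos_of_ne_zero ht) pow_padicValNat_dvd

theorem does_findBlock (hw : 1 ≤ w) (hW : 16 * (n * n) < 2 ^ w) (hs : s.Valid w)
    {t : ℕ} (ht : s.var (B + 4) = t) (htn : t < n) :
    Does w I (findBlock B) s (2 * lowbit (t + 1) + 4) fun s' =>
      s'.var (B + 5) = 2 * lowbit (t + 1) ∧ s'.var (B + 7) = t + 1 - lowbit (t + 1) := by
  have hnn : n ≤ n * n := Nat.le_mul_self n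
  have h2 : 2 < 2 ^ w := by omega
  have hlow : lowbit (t + 1) ≤ t + 1 := lowbit_le (by omega)
  set v := padicValNat 2 (t + 1) with hv
  have hlv : lowbit (t + 1) = 2 ^ v := rfl
  have hvlt : v < 2 ^ v := Nat.lt_two_pow_self
  suffices H : Does w I (findBlock B) s
      (1 + ((∑ k ∈ Finset.range v, (1 + 1) + 1) + 1 + 1) + 1) fun s' =>
      s'.var (B + 5) = 2 * lowbit (t + 1) ∧ s'.var (B + 7) = t + 1 - lowbit (t + 1) by
    refine H.mono ?_ fun _ h => h
    simp only [Finset.sum_const, Finset.card_range, smul_eq_mul, hlv]; omega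
  refine does_seq (does_assign (does_seq (a := ∑ k ∈ Finset.range v, (1 + 1) + 1) (b := 1) ?_))
  have hs1 : (s.setVar (B + 5) ((Expr.const 2).eval w s)).Valid w :=
    hs.setVar _ (Expr.eval_lt hw hs _)
  -- The search starts at `2` and stops at the first power of two that does not divide `t + 1`. This
  -- is twice the largest one that does, hence already the block size.
  refine ((does_loop hw hs1 (fun k s' => s'.var (B + 5) = 2 ^ (k + 1)) (fun _ => 1) v ?_ ?_ ?_).frame
    hw hs1).mono le_rfl ?_
  · simp [State.setVar_var, Expr.eval, Nat.mod_eq_of_lt h2]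
  · rintro k hk s' hs' hag hi
    have e4 : s'.var (B + 4) = t := by
      rw [hag.var _ (by simp [Cmd.WritesVar]), State.setVar_var, if_neg (by omega), ht]
    have hd : 2 ^ (k + 1) ∣ t + 1 := (pow_dvd_pow 2 hk).trans pow_padicValNat_dvd
    refine ⟨?_, does_assign ?_⟩
    · simp only [Expr.eval, e4, hi, Nat.mod_eq_of_lt (by omega : 1 < 2 ^ w),
        Nat.mod_eq_of_lt (by omega : t + 1 < 2 ^ w), Nat.mod_eq_zero_of_dvd hd, Nat.zero_mod]
      simp
    · have hk2 : 2 ^ (k + 1) ≤ 2 ^ v := Nat.pow_le_pow_right (by omega) hk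
      simp only [State.setVar_var, if_true, Expr.eval, hi, Nat.mod_eq_of_lt h2]
      rw [Nat.mod_eq_of_lt (by omega), pow_succ _ (k + 1)]
  · rintro s' hs' hag hi
    have e4 : s'.var (B + 4) = t := by
      rw [hag.var _ (by simp [Cmd.WritesVar]), State.setVar_var, if_neg (by omega), ht]
    have hd : ¬ 2 ^ (v + 1) ∣ t + 1 :=
      pow_succ_padicValNat_not_dvd (by omega)
    simp only [Expr.eval, e4, hi, Nat.mod_eq_of_lt (by omega : 1 < 2 ^ w),
        Nat.mod_eq_of_lt (by omega : t + 1 < 2 ^ w), Nat.zero_mod]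
    rw [if_neg fun h => hd (Nat.dvd_of_mod_eq_zero h)]
  · rintro s' ⟨hs', hag, hi⟩
    have e4 : s'.var (B + 4) = t := by
      rw [hag.var _ (by simp [Cmd.WritesVar]), State.setVar_var, if_neg (by omega), ht]
    refine does_assign ⟨?_, ?_⟩
    · rw [State.setVar_var, if_neg (by omega), hi, hlv, pow_succ, mul_comm]
    · simp only [State.setVar_var, if_true, Expr.eval, e4, hi, Nat.mod_eq_of_lt h2,
        Nat.mod_eq_of_lt (by omega : 1 < 2 ^ w), Nat.mod_eq_of_lt (by omega : t + 1 < 2 ^ w)]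
      rw [pow_succ, Nat.mul_div_cancel _ (by omega), hlv]

end Verification

/-- The graph and the uncovered pairs after the columns before a given one have been processed. -/
def columnState (n : ℕ) (N G U : ℕ → ℕ → Prop) : ℕ → (ℕ → ℕ → Prop) × (ℕ → ℕ → Prop)
  | 0 => (G, U)
  | t + 1 =>
    let G' := fun i j => (columnState n N G U t).1 i j ∨ j = t ∧ (columnState n N G U t).2 i t
    (G', stayUncovered n (t + 1 - lowbit (t + 1)) (2 * lowbit (t + 1)) N G'
      (columnState n N G U t).2)

/-- The graph after the pairs with distance in `[r, (1 + ε) * r)` have been processed. -/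
def scaleGraph (I : RealInput) (n : ℕ) (r : ℝ) (G : ℕ → ℕ → Prop) : ℕ → ℕ → Prop :=
  (columnState n (fun u j => I.dist u j < r / I.alpha) G
    (fun i j => (r ≤ I.dist i j ∧ I.dist i j < r * I.oneAddEps) ∧
      ¬ ∃ u < n, G i u ∧ I.dist u j < r / I.alpha) n).1

/-- The graph after the first scales have been processed. -/
noncomputable def graphAt (I : RealInput) (n : ℕ) (r : ℝ) : ℕ → ℕ → ℕ → Prop
  | 0 => fun _ _ => False
  | k + 1 => scaleGraph I n (r * I.oneAddEps ^ k) (graphAt I n r k)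

/-- Bound each term by the sum of all powers of two dividing `t + 1` and exchange the sums: $2^j$
divides at most $n/2^j$ of the numbers, so each of the $\log_2 n+1$ values of $j$ contributes at
most $n$. -/
theorem sum_lowbit_le (n : ℕ) :
    ∑ t ∈ Finset.range n, lowbit (t + 1) ≤ n * (Nat.log 2 n + 1) := by
  calc ∑ t ∈ Finset.range n, lowbit (t + 1)
      ≤ ∑ t ∈ Finset.range n, ∑ j ∈ Finset.range (Nat.log 2 n + 1),
          if 2 ^ j ∣ t + 1 then 2 ^ j else 0 := by
        refine Finset.sum_le_sum fun t ht => ?_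
        have ht := Finset.mem_range.1 ht
        have h1 : 2 ^ padicValNat 2 (t + 1) ≤ n := (lowbit_le (by omega)).trans ht
        have h2 : padicValNat 2 (t + 1) ∈ Finset.range (Nat.log 2 n + 1) := by
          rw [Finset.mem_range, Nat.lt_succ_iff]
          exact Nat.le_log_of_pow_le (by omega) h1
        refine le_trans ?_ (Finset.single_le_sum (fun _ _ => Nat.zero_le _) h2)
        rw [if_pos pow_padicValNat_dvd, lowbit]
    _ = ∑ j ∈ Finset.range (Nat.log 2 n + 1), n / 2 ^ j * 2 ^ j := by
        rw [Finset.sum_comm]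
        refine Finset.sum_congr rfl fun j _ => ?_
        rw [← Finset.sum_filter, Finset.sum_const, Nat.card_multiples, smul_eq_mul]
    _ ≤ ∑ j ∈ Finset.range (Nat.log 2 n + 1), n :=
        Finset.sum_le_sum fun j _ => Nat.div_mul_le_self _ _
    _ = n * (Nat.log 2 n + 1) := by simp [mul_comm]

/-! ### One scale and the whole program -/

namespace Prog

/-- Marks the pairs whose distance is in the current scale as uncovered. -/
def setClass (B : ℕ) : Cmd :=
  forLt (B + 2) (.mul (.var (B + 1)) (.var (B + 1))) <|
    .seq (.assign (B + 8) (.div (.var (B + 2)) (.var (B + 1)))) <|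
    .seq (.assign (B + 9) (.mod (.var (B + 2)) (.var (B + 1)))) <|
    .seq (.realLoad 3 (.dist (.var (B + 8)) (.var (B + 9)))) <|
    .seq (.realLt (B + 3) 3 0) <|
    .seq (.realLt (B + 10) 3 1) <|
    .write (B + 4) (.var (B + 2)) (.mul (.sub (.const 1) (.var (B + 3))) (.var (B + 10)))

/-- Processes one scale and goes on to the next one. -/
def processScale (B : ℕ) (mm : Cmd) : Cmd :=
  .seq (.realCopy 1 0) <|
  .seq (.realMul 1 .oneAddEps) <|
  .seq (.realCopy 2 0) <|
  .seq (.realDiv 2 .alpha) <|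
  .seq (setClass B) <|
  .seq (.assign (B + 6) (.const 0)) <|
  .seq (.assign (B + 7) (.const 0)) <|
  .seq (.assign (B + 5) (.var (B + 1))) <|
  .seq (blockUpdate B mm) <|
  .seq (sweepColumns B mm) <|
  .realCopy 0 1

/-- Computes the maximum and the minimum nonzero distance and clears the graph. -/
def setup (B : ℕ) : Cmd :=
  .seq (.assign (B + 1) (.var 0)) <|
  .seq (.realLoad 4 (.dist (.const 0) (.const 1))) <|
  .seq (.realCopy 5 4) <|
  forLt (B + 2) (.mul (.var (B + 1)) (.var (B + 1))) <|
    .seq (.assign (B + 8) (.div (.var (B + 2)) (.var (B + 1)))) <|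
    .seq (.assign (B + 9) (.mod (.var (B + 2)) (.var (B + 1)))) <|
    .seq (.realLoad 3 (.dist (.var (B + 8)) (.var (B + 9)))) <|
    .seq (.write (B + 3) (.var (B + 2)) (.const 0)) <|
    .seq (.realLt (B + 3) 4 3) <|
    .seq (.ite (.var (B + 3)) (.realCopy 4 3) (.assign (B + 3) (.const 0))) <|
    .seq (.realLt (B + 3) 3 5) <|
    .ite (.mul (.var (B + 3)) (.sub (.const 1) (.eq (.var (B + 8)) (.var (B + 9)))))
      (.realCopy 5 3) (.assign (B + 3) (.const 0))

/-- Copies the graph to the output array. -/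
def copyOut (B : ℕ) : Cmd :=
  forLt (B + 2) (.mul (.var (B + 1)) (.var (B + 1))) <|
    .write 0 (.var (B + 2)) (.read (B + 3) (.var (B + 2)))

/-- The whole program. -/
def main (B : ℕ) (mm : Cmd) : Cmd :=
  .seq (setup B) <|
  .seq (.realCopy 0 5) <|
  .seq (.realLt (B + 3) 4 0) <|
  .seq (.loop (.eq (.var (B + 3)) (.const 0)) (.seq (processScale B mm) (.realLt (B + 3) 4 0))) <|
  copyOut B

end Prog

/-! ### Correctness and cost of the column sweep, of a scale and of the whole program -/

section Verification

variable {w : ℕ} {I : RealInput} {B n : ℕ} {s : State} {mm : Cmd}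

theorem does_sweepColumns (hw : 1 ≤ w) (hW : 16 * (n * n) < 2 ^ w) (hs : s.Valid w)
    (hB : Fresh B mm) {D : ℕ} (hM : ∀ m, 2 ≤ m → m ≤ 2 * n → Multiplies mm w I m (D * (m * m)))
    (hn : s.var (B + 1) = n) {G U : ℕ → ℕ → Prop} (hG : Rep (s.arr (B + 3)) n G)
    (hU : Rep (s.arr (B + 4)) n U) :
    Does w I (sweepColumns B mm) s ((6 * D + 250) * (n * (n * (Nat.log 2 n + 1))) + 3) fun s' =>
      Rep (s'.arr (B + 3)) n (columnState n (fun u j => I.dist u j < s.real 2) G U n).1 := by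
  have hnn : n ≤ n * n := Nat.le_mul_self n
  have h2 : 1 < 2 ^ w := Nat.one_lt_two_pow (by omega)
  refine (does_forLt hw hs
    (fun k s' =>
      Rep (s'.arr (B + 3)) n (columnState n (fun u j => I.dist u j < s.real 2) G U k).1 ∧
      Rep (s'.arr (B + 4)) n (columnState n (fun u j => I.dist u j < s.real 2) G U k).2)
    (fun k => (6 * D + 247) * (n * lowbit (k + 1))) n (by omega) ?_ ?_ ?_ ?_).mono ?_ ?_
  · simp [selectColumn, findBlock, sweepRows, blockUpdate, fillBlock, applyBlock, forLt,
      Cmd.WritesVar, hB.var]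
  · intro s' h
    rw [← hn]
    exact h.var _ (by simp [selectColumn, findBlock, sweepRows, blockUpdate,
      fillBlock, applyBlock, forLt, Cmd.WritesVar, hB.var])
  · exact ⟨hG, hU⟩
  · rintro k hk s' hs' hag hx ⟨hi1, hi2⟩
    have e1 : s'.var (B + 1) = n := by
      rw [← hn]
      exact hag.var _ (by simp [selectColumn, findBlock, sweepRows, blockUpdate,
        fillBlock, applyBlock, forLt, Cmd.WritesVar, hB.var])
    have er : s'.real 2 = s.real 2 :=
      hag.real _ (by simp [selectColumn, findBlock, sweepRows, blockUpdate,
        fillBlock, applyBlock, forLt, Cmd.WritesReal, hB.real])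
    have hlow : lowbit (k + 1) ≤ k + 1 := lowbit_le (by omega)
    have hlow1 : 1 ≤ lowbit (k + 1) := Nat.one_le_two_pow
    set m := 2 * lowbit (k + 1) with hm
    suffices H : Does w I (.seq (selectColumn B) (.seq (findBlock B) (sweepRows B mm))) s'
        ((n * 5 + 3) + ((m + 4) + ((n + m - 1) / m * (m * m * 25 + D * (m * m) + 13) + 3) + 1) + 1)
        fun s'' => Rep (s''.arr (B + 3)) n
            (columnState n (fun u j => I.dist u j < s.real 2) G U (k + 1)).1 ∧
          Rep (s''.arr (B + 4)) n
            (columnState n (fun u j => I.dist u j < s.real 2) G U (k + 1)).2 by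
      refine H.mono ?_ fun s'' h => h
      -- The padded rows number at most `n + m - 1`, and `m ≤ 2 * n`. So the `n / m` products of
      -- cost about `D * m ^ 2` amount to about `D * n * m`, linear in the block size.
      have c1 : (n + m - 1) / m * m ≤ 3 * n := (Nat.div_mul_le_self _ _).trans (by omega)
      have c2 : (n + m - 1) / m * (m * m * 25 + D * (m * m) + 13) ≤ 3 * n * (m * (D + 38)) :=
        calc _ ≤ (n + m - 1) / m * (m * (m * (D + 38))) := by
              refine Nat.mul_le_mul_left _ ?_
              nlinarith [Nat.mul_le_mul hlow1 hlow1]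
          _ = (n + m - 1) / m * m * (m * (D + 38)) := by ring
          _ ≤ _ := Nat.mul_le_mul_right _ c1
      have c3 : 1 * lowbit (k + 1) ≤ n * lowbit (k + 1) := Nat.mul_le_mul_right _ (by omega)
      have c4 : n * 1 ≤ n * lowbit (k + 1) := Nat.mul_le_mul_left _ hlow1
      have c5 : 3 * n * (m * (D + 38)) =
          (6 * D + 228) * (n * lowbit (k + 1)) := by rw [hm]; ring
      have c6 : (6 * D + 247) * (n * lowbit (k + 1)) =
        (6 * D + 228) * (n * lowbit (k + 1)) + 19 * (n * lowbit (k + 1)) := by ring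
      omega
    refine does_seq (((does_selectColumn hw hW hs' e1 hx hk hi1 hi2).frame hw hs').mono le_rfl ?_)
    rintro s1 ⟨hs1, ha1, hG1⟩
    have t1 : s1.var (B + 4) = k := by
      rw [ha1.var _ (by simp [selectColumn, forLt, Cmd.WritesVar]), hx]
    refine does_seq (((does_findBlock hw hW hs1 t1 hk).frame hw hs1).mono le_rfl ?_)
    rintro s3 ⟨hs3, ha3, hm3, hl3⟩
    have n3 : s3.var (B + 1) = n := by
      rw [ha3.var _ (by simp [findBlock, Cmd.WritesVar]),
        ha1.var _ (by simp [selectColumn, forLt, Cmd.WritesVar]), e1]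
    have g3 : s3.arr (B + 3) = s1.arr (B + 3) :=
      ha3.arr _ (by simp [findBlock, Cmd.WritesArr])
    have u3 : s3.arr (B + 4) = s'.arr (B + 4) := by
      rw [ha3.arr _ (by simp [findBlock, Cmd.WritesArr]),
        ha1.arr _ (by simp [selectColumn, forLt, Cmd.WritesArr])]
    have r3 : s3.real 2 = s.real 2 := by
      rw [ha3.real _ (by simp [findBlock, Cmd.WritesReal]),
        ha1.real _ (by simp [selectColumn, forLt, Cmd.WritesReal]), er]
    refine ((does_sweepRows hw hW hs3 hB (hM m (by omega) (by omega)) (by omega) n3 hm3 hl3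
      (by omega) (by omega) (g3 ▸ hG1) (u3 ▸ hi2)).frame hw hs3).mono le_rfl ?_
    rintro s4 ⟨hs4, ha4, hU4⟩
    refine ⟨?_, ?_⟩
    · rw [ha4.arr _ (by simp [sweepRows, blockUpdate, fillBlock, applyBlock, forLt,
        Cmd.WritesArr, hB.arr]), g3]
      exact hG1
    · rw [r3] at hU4
      exact hU4
  · have c1 : ∀ k ∈ Finset.range n, (6 * D + 247) * (n * lowbit (k + 1)) + 3 ≤
        (6 * D + 250) * (n * lowbit (k + 1)) := by
      intro k hk
      have hk := Finset.mem_range.1 hk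
      have : 1 * 1 ≤ n * lowbit (k + 1) := Nat.mul_le_mul (by omega) Nat.one_le_two_pow
      nlinarith
    refine Nat.add_le_add_right ((Finset.sum_le_sum c1).trans ?_) 3
    rw [← Finset.mul_sum, ← Finset.mul_sum]
    exact Nat.mul_le_mul_left _ (Nat.mul_le_mul_left _ (sum_lowbit_le n))
  · exact fun s' h => h.1

theorem does_setClass (hw : 1 ≤ w) (hW : 16 * (n * n) < 2 ^ w) (hs : s.Valid w)
    (hn : s.var (B + 1) = n) :
    Does w I (setClass B) s (n * n * 14 + 3) fun s' =>
      Rep (s'.arr (B + 4)) n fun i j => s.real 0 ≤ I.dist i j ∧ I.dist i j < s.real 1 := by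
  have hnn : n ≤ n * n := Nat.le_mul_self n
  have h2 : 1 < 2 ^ w := Nat.one_lt_two_pow (by omega)
  refine (does_forLt hw hs
    (fun k s' => ∀ q < k, s'.arr (B + 4) q = 0 ∧ ¬ (s.real 0 ≤ I.dist (q / n) (q % n) ∧
        I.dist (q / n) (q % n) < s.real 1) ∨ s'.arr (B + 4) q = 1 ∧
        (s.real 0 ≤ I.dist (q / n) (q % n) ∧ I.dist (q / n) (q % n) < s.real 1))
    (fun _ => 11) (n * n) (by omega) ?_ ?_ ?_ ?_).mono ?_ ?_
  · simp [Cmd.WritesVar]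
  · intro s' h
    have : s'.var (B + 1) = n := by
      rw [← hn]; exact h.var _ (by simp [forLt, Cmd.WritesVar])
    simp only [Expr.eval, this]
    exact Nat.mod_eq_of_lt (by omega)
  · simp
  · rintro k hk s' hs' hag hx hi
    have e1 : s'.var (B + 1) = n := by
      rw [← hn]; exact hag.var _ (by simp [forLt, Cmd.WritesVar])
    have r0 : s'.real 0 = s.real 0 := hag.real _ (by simp [forLt, Cmd.WritesReal])
    have r1 : s'.real 1 = s.real 1 := hag.real _ (by simp [forLt, Cmd.WritesReal])
    refine does_seq (does_assign <| does_seq <| does_assign <|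
      does_seq <| does_realLoad <| does_seq <| does_realLt <| does_seq <| does_realLt <|
      does_write ?_)
    simp only [Expr.eval, RealRef.eval, State.setVar_var, State.setVar_arr, State.setVar_real,
      State.setArr_arr, State.setReal_var, State.setReal_arr, State.setReal_real, hx, e1, r0, r1]
    intro q hq
    by_cases hqk : q = k
    · subst hqk
      by_cases c1 : I.dist (q / n) (q % n) < s.real 0 <;>
      by_cases c2 : I.dist (q / n) (q % n) < s.real 1 <;>
        simp [c1, c2, Nat.mod_eq_of_lt h2]
      · exact not_lt.1 c1
    · simpa [hqk] using hi q (by omega)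
  · simp
  · exact fun _ h => h

theorem does_processScale (hw : 1 ≤ w) (hW : 16 * (n * n) < 2 ^ w) (hs : s.Valid w)
    (hB : Fresh B mm) (hn2 : 2 ≤ n) {D : ℕ}
    (hM : ∀ m, 2 ≤ m → m ≤ 2 * n → Multiplies mm w I m (D * (m * m)))
    (hn : s.var (B + 1) = n) {G : ℕ → ℕ → Prop} (hG : Rep (s.arr (B + 3)) n G) :
    Does w I (processScale B mm) s ((7 * D + 350) * (n * (n * (Nat.log 2 n + 1)))) fun s' =>
      Rep (s'.arr (B + 3)) n (scaleGraph I n (s.real 0) G) ∧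
      s'.real 0 = s.real 0 * I.oneAddEps := by
  have hnn : n ≤ n * n := Nat.le_mul_self n
  have h2 : 1 < 2 ^ w := Nat.one_lt_two_pow (by omega)
  set L := n * (n * (Nat.log 2 n + 1)) with hL
  suffices H : Does w I (processScale B mm) s
      (1 + (1 + (1 + (1 + ((n * n * 14 + 3) + (1 + (1 + (1 + ((n * n * 25 + D * (n * n) + 10) +
      (((6 * D + 250) * L + 3) + 1 + 1) + 1) + 1) + 1) + 1) + 1) + 1) + 1) + 1) + 1)
      fun s' => Rep (s'.arr (B + 3)) n (scaleGraph I n (s.real 0) G) ∧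
      s'.real 0 = s.real 0 * I.oneAddEps by
    refine H.mono ?_ fun _ h => h
    have c1 : n * n * 1 ≤ n * n * (Nat.log 2 n + 1) := Nat.mul_le_mul_left _ (by omega)
    have c2 : n * n * (Nat.log 2 n + 1) = L := by rw [hL]; ring
    have c3 : D * (n * n) ≤ D * L := Nat.mul_le_mul_left _ (by omega)
    have c4 : 2 * 2 ≤ n * n := Nat.mul_le_mul hn2 hn2
    have c5 : (7 * D + 350) * L = (6 * D + 250) * L + D * L + 100 * L := by ring
    omega
  refine does_seq <| does_realCopy <| does_seq <| does_realMul <| does_seq <| does_realCopy <|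
    does_seq <| does_realDiv <| does_seq ?_
  set s0 := (((s.setReal 1 (s.real 0)).setReal 1 _).setReal 2 _).setReal 2 _ with hs0
  have v0 : s0.Valid w := hs
  have q0 : s0.real 0 = s.real 0 := by simp [hs0, State.setReal_real]
  have q1 : s0.real 1 = s.real 0 * I.oneAddEps := by
    simp [hs0, State.setReal_real, RealRef.eval]
  have q2 : s0.real 2 = s.real 0 / I.alpha := by
    simp [hs0, State.setReal_real, RealRef.eval]
  have n0 : s0.var (B + 1) = n := hn
  have g0 : s0.arr (B + 3) = s.arr (B + 3) := rfl
  clear_value s0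
  refine ((does_setClass hw hW v0 n0).frame hw v0).mono le_rfl ?_
  rintro s1 ⟨v1, a1, u1⟩
  rw [q0, q1] at u1
  refine does_seq <| does_assign <| does_seq <| does_assign <| does_seq <| does_assign <|
    does_seq (a := n * n * 25 + D * (n * n) + 10) ?_
  set s2 := ((s1.setVar _ _).setVar _ _).setVar _ _ with hs2
  have n1 : s1.var (B + 1) = n := by
    rw [a1.var _ (by simp [setClass, forLt, Cmd.WritesVar]), n0]
  have v2 : s2.Valid w := by
    refine State.Valid.setVar (State.Valid.setVar (State.Valid.setVar v1 _ ?_) _ ?_) _ ?_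
    · simp [Expr.eval]
    · simp [Expr.eval]
    · simp only [Expr.eval, State.setVar_var]
      rw [if_neg (by omega), if_neg (by omega), n1]; omega
  have n2 : s2.var (B + 1) = n := by
    simp [hs2, State.setVar_var, n1]
  have m2 : s2.var (B + 5) = n := by
    simp [hs2, State.setVar_var, Expr.eval, n1]
  have b2 : s2.var (B + 6) = 0 := by
    simp [hs2, State.setVar_var, Expr.eval]
  have l2 : s2.var (B + 7) = 0 := by
    simp [hs2, State.setVar_var, Expr.eval]
  have g2 : s2.arr (B + 3) = s.arr (B + 3) := by
    rw [hs2]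
    exact (a1.arr _ (by simp [setClass, forLt, Cmd.WritesArr])).trans g0
  have u2 : s2.arr (B + 4) = s1.arr (B + 4) := rfl
  have r2 : s2.real 2 = s.real 0 / I.alpha := by
    rw [hs2]
    exact (a1.real _ (by simp [setClass, forLt, Cmd.WritesReal])).trans q2
  have r1 : s2.real 1 = s.real 0 * I.oneAddEps := by
    rw [hs2]
    exact (a1.real _ (by simp [setClass, forLt, Cmd.WritesReal])).trans q1
  clear_value s2
  -- One update with the full matrix as its block removes the pairs that edges from earlier scales
  -- already cover.
  refine ((does_blockUpdate hw hW v2 hB (hM n hn2 (by omega)) n2 m2 b2 l2 (by omega) (by omega)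
    (by omega) (g2 ▸ hG) (u2 ▸ u1)).frame hw v2).mono le_rfl ?_
  rintro s3 ⟨v3, a3, u3⟩
  have n3 : s3.var (B + 1) = n := by
    rw [a3.var _ (by simp [blockUpdate, fillBlock, applyBlock, forLt, Cmd.WritesVar, hB.var]), n2]
  have g3 : s3.arr (B + 3) = s.arr (B + 3) := by
    rw [a3.arr _ (by simp [blockUpdate, fillBlock, applyBlock, forLt, Cmd.WritesArr, hB.arr]), g2]
  have q3 : ∀ i, i ≠ 3 → s3.real i = s2.real i := fun i hi =>
    a3.real _ (by simp [blockUpdate, fillBlock, applyBlock, forLt, Cmd.WritesReal, hB.real,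
      hi.symm])
  have u3' : Rep (s3.arr (B + 4)) n fun i j =>
      (s.real 0 ≤ I.dist i j ∧ I.dist i j < s.real 0 * I.oneAddEps) ∧
      ¬ ∃ u < n, G i u ∧ I.dist u j < s.real 0 / I.alpha := by
    refine u3.congr fun i hi j hj => and_congr_right fun _ => not_congr ?_
    simp [hi, hj, r2]
  refine does_seq (a := (6 * D + 250) * L + 3) (b := 1) (((does_sweepColumns hw hW v3 hB hM n3
    (g3 ▸ hG) u3').frame hw v3).mono le_rfl ?_)
  rintro s4 ⟨v4, a4, g4⟩
  refine does_realCopy ⟨?_, ?_⟩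
  · rw [q3 2 (by omega), r2] at g4
    exact g4
  · rw [State.setReal_real, if_pos rfl,
      a4.real _ (by simp [sweepColumns, selectColumn, findBlock, sweepRows, blockUpdate,
        fillBlock, applyBlock, forLt, Cmd.WritesReal, hB.real]), q3 1 (by omega), r1]

end Verification

section Verification

variable {w : ℕ} {I : RealInput} {B n : ℕ} {s : State} {mm : Cmd}

theorem does_setup (hw : 1 ≤ w) (hW : 16 * (n * n) < 2 ^ w) (hs : s.Valid w) (hn2 : 2 ≤ n)
    (hn : s.var 0 = n) :
    Does w I (setup B) s (n * n * 20 + 9) fun s' =>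
      s'.var (B + 1) = n ∧ (∃ i < n, ∃ j < n, s'.real 4 = I.dist i j) ∧
      (∀ i < n, ∀ j < n, I.dist i j ≤ s'.real 4) ∧
      (∃ i < n, ∃ j < n, i ≠ j ∧ s'.real 5 = I.dist i j) ∧
      (∀ i < n, ∀ j < n, i ≠ j → s'.real 5 ≤ I.dist i j) ∧
      Rep (s'.arr (B + 3)) n fun _ _ => False := by
  have hnn : n ≤ n * n := Nat.le_mul_self n
  have h2 : 1 < 2 ^ w := Nat.one_lt_two_pow (by omega)
  suffices H : Does w I (setup B) s (1 + (1 + (1 + (n * n * 20 + 3) + 1) + 1) + 1) fun s' =>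
      s'.var (B + 1) = n ∧ (∃ i < n, ∃ j < n, s'.real 4 = I.dist i j) ∧
      (∀ i < n, ∀ j < n, I.dist i j ≤ s'.real 4) ∧
      (∃ i < n, ∃ j < n, i ≠ j ∧ s'.real 5 = I.dist i j) ∧
      (∀ i < n, ∀ j < n, i ≠ j → s'.real 5 ≤ I.dist i j) ∧
      Rep (s'.arr (B + 3)) n fun _ _ => False from H.mono (by omega) fun _ h => h
  refine does_seq <| does_assign <| does_seq <| does_realLoad <| does_seq <| does_realCopy ?_
  -- Maximum and minimum both start from the distance of the points `0` and `1`. These are distinct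
  -- as `n ≥ 2`, so the minimum always ranges over distinct points.
  set s1 := ((s.setVar (B + 1) ((Expr.var 0).eval w s)).setReal 4 _).setReal 5 _ with hs1
  have v1 : s1.Valid w := hs.setVar _ (Expr.eval_lt hw hs _)
  have n1 : s1.var (B + 1) = n := by
    simp [hs1, State.setReal_var, State.setVar_var, Expr.eval, hn]
  have m1 : s1.real 4 = I.dist 0 1 := by
    simp [hs1, State.setReal_real, RealRef.eval, Expr.eval, Nat.mod_eq_of_lt h2]
  have k1 : s1.real 5 = I.dist 0 1 := by
    simp [hs1, State.setReal_real, RealRef.eval, Expr.eval, Nat.mod_eq_of_lt h2]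
  clear_value s1
  refine ((does_forLt hw v1
    (fun k s' => (∃ i < n, ∃ j < n, s'.real 4 = I.dist i j) ∧
      (∀ q < k, I.dist (q / n) (q % n) ≤ s'.real 4) ∧
      (∃ i < n, ∃ j < n, i ≠ j ∧ s'.real 5 = I.dist i j) ∧
      (∀ q < k, q / n ≠ q % n → s'.real 5 ≤ I.dist (q / n) (q % n)) ∧
      ∀ q < k, s'.arr (B + 3) q = 0)
    (fun _ => 17) (n * n) (by omega) ?_ ?_ ?_ ?_).frame hw v1).mono ?_ ?_
  · simp [Cmd.WritesVar]
  · intro s' h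
    have : s'.var (B + 1) = n := by
      rw [← n1]; exact h.var _ (by simp [forLt, Cmd.WritesVar])
    simp only [Expr.eval, this]
    exact Nat.mod_eq_of_lt (by omega)
  · simp only [State.setVar_real, State.setVar_arr, m1, k1]
    exact ⟨⟨0, by omega, 1, by omega, rfl⟩, by simp, ⟨0, by omega, 1, by omega, by simp, rfl⟩,
      by simp, by simp⟩
  · rintro k hk s' hs' hag hx ⟨i1, i2, i3, i4, i5⟩
    have e1 : s'.var (B + 1) = n := by
      rw [← n1]; exact hag.var _ (by simp [forLt, Cmd.WritesVar])
    have hq1 : k / n < n := Nat.div_lt_of_lt_mul hk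
    have hq2 : k % n < n := Nat.mod_lt _ (by omega)
    refine does_seq <| does_assign <| does_seq <| does_assign <| does_seq <| does_realLoad <|
      does_seq <| does_write <| does_seq <| does_realLt <| does_seq (a := 2) (b := 4) ?_
    set s2 := (((((s'.setVar (B + 8) _).setVar (B + 9) _).setReal 3 _).setArr (B + 3) _ _).setVar
      (B + 3) _) with hs2
    have a2 : s2.var (B + 8) = k / n := by
      simp [hs2, State.setArr_var, State.setReal_var, State.setVar_var, Expr.eval, hx, e1]
    have b2 : s2.var (B + 9) = k % n := by
      simp [hs2, State.setArr_var, State.setReal_var, State.setVar_var, Expr.eval, hx, e1]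
    have r3 : s2.real 3 = I.dist (k / n) (k % n) := by
      simp [hs2, State.setArr_real, State.setReal_real, State.setVar_real, State.setVar_var,
        RealRef.eval, Expr.eval, hx, e1]
    have r4 : s2.real 4 = s'.real 4 := by
      simp [hs2, State.setArr_real, State.setReal_real, State.setVar_real]
    have r5 : s2.real 5 = s'.real 5 := by
      simp [hs2, State.setArr_real, State.setReal_real, State.setVar_real]
    have x2 : s2.var (B + 3) = if s'.real 4 < I.dist (k / n) (k % n) then 1 else 0 := by
      simp [hs2, State.setArr_real, State.setReal_real, State.setVar_real, State.setVar_var,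
        RealRef.eval, Expr.eval, hx, e1]
    have g2 : ∀ q < k + 1, s2.arr (B + 3) q = 0 := by
      intro q hq
      simp only [hs2, State.setVar_arr, State.setArr_arr, true_and]
      split_ifs with h
      · simp [Expr.eval]
      · have : q ≠ k := by
          simpa [Expr.eval, State.setReal_var, State.setVar_var, hx] using h
        exact i5 q (by omega)
    clear_value s2
    have H3 : Does w I (.ite (.var (B + 3)) (.realCopy 4 3) (.assign (B + 3) (.const 0))) s2 2
        fun s3 => s3.var (B + 8) = k / n ∧ s3.var (B + 9) = k % n ∧
          s3.real 3 = I.dist (k / n) (k % n) ∧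
          s3.real 4 = max (s'.real 4) (I.dist (k / n) (k % n)) ∧ s3.real 5 = s'.real 5 ∧
          s3.arr (B + 3) = s2.arr (B + 3) := by
      refine does_ite (N := 1) (fun he => does_realCopy ?_) fun he => does_assign ?_
      · have hlt : s'.real 4 < I.dist (k / n) (k % n) := by
          simpa [Expr.eval, x2] using he
        simp [State.setReal_var, State.setReal_real, State.setReal_arr, a2, b2, r3, r5, hlt.le]
      · have hlt : ¬ s'.real 4 < I.dist (k / n) (k % n) := by
          simpa [Expr.eval, x2] using he
        simp [State.setVar_var, State.setVar_real, State.setVar_arr, a2, b2, r3, r4, r5,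
          not_lt.1 hlt]
    refine H3.mono le_rfl ?_
    rintro s3 ⟨a3, b3, c3, m3, k3, g3⟩
    have hmax : (∃ i < n, ∃ j < n, max (s'.real 4) (I.dist (k / n) (k % n)) = I.dist i j) ∧
        (∀ q < k + 1, I.dist (q / n) (q % n) ≤ max (s'.real 4) (I.dist (k / n) (k % n))) := by
      constructor
      · rcases max_choice (s'.real 4) (I.dist (k / n) (k % n)) with h | h <;> rw [h]
        exacts [i1, ⟨_, hq1, _, hq2, rfl⟩]
      · intro q hq
        rcases (Nat.lt_succ_iff.1 hq).eq_or_lt with rfl | hq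
        exacts [le_max_right _ _, (i2 q hq).trans (le_max_left _ _)]
    -- The minimum is lowered only off the diagonal, where the second factor is `1`.
    have hev : (Expr.mul (.var (B + 3)) (.sub (.const 1) (.eq (.var (B + 8)) (.var (B + 9))))).eval w
        (s3.setVar (B + 3) (if s3.real 3 < s3.real 5 then 1 else 0)) =
        if I.dist (k / n) (k % n) < s'.real 5 ∧ k / n ≠ k % n then 1 else 0 := by
      by_cases c1 : I.dist (k / n) (k % n) < s'.real 5 <;> by_cases c2 : k / n = k % n <;>
        simp [Expr.eval, State.setVar_var, c3, k3, a3, b3, Nat.mod_eq_of_lt h2, c1, c2]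
    refine does_seq (a := 1) (b := 2) (does_realLt (does_ite (N := 1) (fun he => does_realCopy ?_)
      fun he => does_assign ?_))
    · have he' : I.dist (k / n) (k % n) < s'.real 5 ∧ k / n ≠ k % n := by
        by_contra hc
        exact he (by rw [hev, if_neg hc])
      refine ⟨?_, ?_, ⟨_, hq1, _, hq2, he'.2, ?_⟩, ?_, ?_⟩
      · simpa [State.setVar_real, State.setReal_real, m3] using hmax.1
      · simpa [State.setVar_real, State.setReal_real, m3] using hmax.2
      · simp [State.setVar_real, State.setReal_real, c3]
      · intro q hq hne
        simp only [State.setVar_real, State.setReal_real, if_true, c3]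
        rcases (Nat.lt_succ_iff.1 hq).eq_or_lt with rfl | hq
        exacts [le_rfl, he'.1.le.trans (i4 q hq hne)]
      · simpa [State.setVar_arr, State.setReal_arr, g3] using g2
    · have he' : k / n ≠ k % n → s'.real 5 ≤ I.dist (k / n) (k % n) := by
        intro hne
        by_contra hc
        rw [hev, if_pos ⟨not_le.1 hc, hne⟩] at he
        exact one_ne_zero he
      refine ⟨?_, ?_, ?_, ?_, ?_⟩
      · simpa [State.setVar_real, m3] using hmax.1
      · simpa [State.setVar_real, m3] using hmax.2
      · simpa [State.setVar_real, k3] using i3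
      · intro q hq hne
        simp only [State.setVar_real, k3]
        rcases (Nat.lt_succ_iff.1 hq).eq_or_lt with rfl | hq
        exacts [he' hne, i4 q hq hne]
      · simpa [State.setVar_arr, g3] using g2
  · simp
  · rintro s' ⟨hs', hag, i1, i2, i3, i4, i5⟩
    refine ⟨?_, i1, fun i hi j hj => ?_, i3, fun i hi j hj hne => ?_, fun q hq => ?_⟩
    · rw [← n1]; exact hag.var _ (by simp [forLt, Cmd.WritesVar])
    · have := i2 _ (mul_add_lt_mul hi hj)
      rwa [mul_add_div' hj, mul_add_mod' hj] at this
    · have := i4 _ (mul_add_lt_mul hi hj)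
      rw [mul_add_div' hj, mul_add_mod' hj] at this
      exact this hne
    · exact .inl ⟨i5 q hq, id⟩

theorem does_copyOut (hw : 1 ≤ w) (hW : 16 * (n * n) < 2 ^ w) (hs : s.Valid w)
    (hn : s.var (B + 1) = n) {G : ℕ → ℕ → Prop} (hG : Rep (s.arr (B + 3)) n G) :
    Does w I (copyOut B) s (n * n * 4 + 3) fun s' => Rep (s'.arr 0) n G := by
  have hnn : n ≤ n * n := Nat.le_mul_self n
  refine (does_forLt hw hs (fun k s' => ∀ q < k, s'.arr 0 q = s.arr (B + 3) q)
    (fun _ => 1) (n * n) (by omega) ?_ ?_ ?_ ?_).mono ?_ ?_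
  · simp [Cmd.WritesVar]
  · intro s' h
    have : s'.var (B + 1) = n := by
      rw [← hn]; exact h.var _ (by simp [forLt, Cmd.WritesVar])
    simp only [Expr.eval, this]
    exact Nat.mod_eq_of_lt (by omega)
  · simp
  · rintro k hk s' hs' hag hx hi
    have e3 : s'.arr (B + 3) = s.arr (B + 3) := hag.arr _ (by simp [forLt, Cmd.WritesArr])
    refine does_write fun q hq => ?_
    simp only [Expr.eval, State.setVar_arr, State.setArr_arr, hx, true_and, e3]
    split_ifs with h
    · rw [h]
    · exact hi q (by omega)
  · simp
  · exact fun s' h q hq => by rw [h q hq]; exact hG q hq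

/-- The loop runs while the scale does not exceed the maximum distance; `hJ` and `hJ'` say that this
happens for exactly `J` scales. -/
theorem does_main (hw : 1 ≤ w) (hW : 16 * (n * n) < 2 ^ w) (hs : s.Valid w)
    (hB : Fresh B mm) (hn2 : 2 ≤ n) {D : ℕ}
    (hM : ∀ m, 2 ≤ m → m ≤ 2 * n → Multiplies mm w I m (D * (m * m)))
    (hn : s.var 0 = n) {mx mn : ℝ} {J : ℕ}
    (hmx : ∃ i < n, ∃ j < n, mx = I.dist i j) (hmx' : ∀ i < n, ∀ j < n, I.dist i j ≤ mx)
    (hmn : ∃ i < n, ∃ j < n, i ≠ j ∧ mn = I.dist i j)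
    (hmn' : ∀ i < n, ∀ j < n, i ≠ j → mn ≤ I.dist i j)
    (hJ : ∀ k < J, mn * I.oneAddEps ^ k ≤ mx) (hJ' : mx < mn * I.oneAddEps ^ J) :
    Does w I (main B mm) s ((J + 1) * ((7 * D + 360) * (n * (n * (Nat.log 2 n + 1))))) fun s' =>
      Rep (s'.arr 0) n (graphAt I n mn J) := by
  have hnn : n ≤ n * n := Nat.le_mul_self n
  have h2 : 1 < 2 ^ w := Nat.one_lt_two_pow (by omega)
  set L := n * (n * (Nat.log 2 n + 1)) with hL
  suffices H : Does w I (main B mm) s ((n * n * 20 + 9) + (1 + (1 +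
      ((∑ _k ∈ Finset.range J, (((7 * D + 350) * L + 1 + 1) + 1) + 1) + (n * n * 4 + 3) + 1) + 1)
      + 1) + 1) fun s' => Rep (s'.arr 0) n (graphAt I n mn J) by
    refine H.mono ?_ fun _ h => h
    have c1 : n * n * 1 ≤ n * n * (Nat.log 2 n + 1) := Nat.mul_le_mul_left _ (by omega)
    have c2 : n * n * (Nat.log 2 n + 1) = L := by rw [hL]; ring
    have c4 : 2 * 2 ≤ n * n := Nat.mul_le_mul hn2 hn2
    have c6 : J * ((7 * D + 350) * L + 1 + 1 + 1) ≤ J * ((7 * D + 360) * L) := by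
      refine Nat.mul_le_mul_left _ ?_
      have c5 : (7 * D + 360) * L = (7 * D + 350) * L + 10 * L := by ring
      omega
    have c7 : (J + 1) * ((7 * D + 360) * L) =
      J * ((7 * D + 360) * L) + 7 * (D * L) + 360 * L := by ring
    simp only [Finset.sum_const, Finset.card_range, smul_eq_mul]
    omega
  refine does_seq (((does_setup hw hW hs hn2 hn).frame hw hs).mono le_rfl ?_)
  rintro s1 ⟨v1, -, n1, ⟨x1, x1h, x2, x2h, hx1⟩, hx2, ⟨y1, y1h, y2, y2h, hyne, hy1⟩, hy2, g1⟩
  have q4 : s1.real 4 = mx := by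
    obtain ⟨i, hi, j, hj, h⟩ := hmx
    exact le_antisymm (hx1 ▸ hmx' _ x1h _ x2h) (h ▸ hx2 _ hi _ hj)
  have q5 : s1.real 5 = mn := by
    obtain ⟨i, hi, j, hj, hne, h⟩ := hmn
    exact le_antisymm (h ▸ hy2 _ hi _ hj hne) (hy1 ▸ hmn' _ y1h _ y2h hyne)
  refine does_seq <| does_realCopy <| does_seq <| does_realLt <|
    does_seq (a := ∑ _k ∈ Finset.range J, (((7 * D + 350) * L + 1 + 1) + 1) + 1)
      (b := n * n * 4 + 3) ?_
  set s2 := (s1.setReal 0 (s1.real 5)).setVar (B + 3) _ with hs2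
  have v2 : s2.Valid w := State.Valid.setVar v1 _ (by split_ifs <;> omega)
  have n2 : s2.var (B + 1) = n := by simp [hs2, State.setVar_var, State.setReal_var, n1]
  have r0 : s2.real 0 = mn := by simp [hs2, State.setVar_real, State.setReal_real, q5]
  have r4 : s2.real 4 = mx := by simp [hs2, State.setVar_real, State.setReal_real, q4]
  have x2 : s2.var (B + 3) = if mx < mn then 1 else 0 := by
    simp [hs2, State.setVar_var, State.setReal_real, q4, q5]
  have g2 : s2.arr (B + 3) = s1.arr (B + 3) := rfl
  clear_value s2
  refine ((does_loop hw v2 (fun k s' => s'.real 0 = mn * I.oneAddEps ^ k ∧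
      s'.var (B + 3) = (if mx < mn * I.oneAddEps ^ k then 1 else 0) ∧
      Rep (s'.arr (B + 3)) n (graphAt I n mn k)) (fun _ => (7 * D + 350) * L + 1 + 1) J
      ?_ ?_ ?_).frame hw v2).mono le_rfl ?_
  · simp only [pow_zero, mul_one]
    exact ⟨r0, x2, g2 ▸ g1⟩
  · rintro k hk s' hs' hag ⟨i1, i2, i3⟩
    have e1 : s'.var (B + 1) = n := by
      rw [hag.var _ (by simp [processScale, setClass, sweepColumns, selectColumn, findBlock,
        sweepRows, blockUpdate, fillBlock, applyBlock, forLt, Cmd.WritesVar, hB.var]), n2]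
    have e4 : s'.real 4 = mx := by
      rw [hag.real _ (by simp [processScale, setClass, sweepColumns, selectColumn, findBlock,
        sweepRows, blockUpdate, fillBlock, applyBlock, forLt, Cmd.WritesReal, hB.real]), r4]
    refine ⟨by simp [Expr.eval, i2, hJ k hk], does_seq (a := (7 * D + 350) * L) (b := 1) ?_⟩
    refine ((does_processScale hw hW hs' hB hn2 hM e1 i3).frame hw hs').mono le_rfl ?_
    rintro s3 ⟨v3, a3, g3, q3⟩
    have p4 : s3.real 4 = mx := by
      rw [a3.real _ (by simp [processScale, setClass, sweepColumns, selectColumn, findBlock,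
        sweepRows, blockUpdate, fillBlock, applyBlock, forLt, Cmd.WritesReal, hB.real]), e4]
    have p0 : s3.real 0 = mn * I.oneAddEps ^ (k + 1) := by
      rw [q3, i1, pow_succ, mul_assoc]
    refine does_realLt ⟨p0, ?_, ?_⟩
    · rw [State.setVar_var, if_pos rfl, p4, p0]
    · rw [State.setVar_arr, graphAt, ← i1]; exact g3
  · rintro s' hs' hag ⟨i1, i2, i3⟩
    simp [Expr.eval, i2, hJ']
  · rintro s' ⟨hs', hag, i1, i2, i3⟩
    refine does_copyOut hw hW hs' ?_ i3
    rw [hag.var _ (by simp [processScale, setClass, sweepColumns, selectColumn, findBlock,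
        sweepRows, blockUpdate, fillBlock, applyBlock, forLt, Cmd.WritesVar, hB.var]), n2]

end Verification

/-! ### The graph that the program computes -/

theorem pow_le_lowbit {a x : ℕ} (hx : x ≠ 0) (h : 2 ^ a ∣ x) : 2 ^ a ≤ lowbit x :=
  Nat.pow_le_pow_right (by omega) ((padicValNat_dvd_iff_le hx).1 h)

/-- Take the `T` in `(u, j]` divisible by the highest power of two. Both `T - lowbit T` and `T +
lowbit T` are divisible by a higher one unless zero, so by maximality neither lies in `(u, j]`. -/
theorem exists_lowbit_block {u j : ℕ} (h : u < j) :
    ∃ T, u < T ∧ T ≤ j ∧ T - lowbit T ≤ u ∧ j < T + lowbit T := by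
  obtain ⟨T, hT, hmax⟩ := Finset.exists_max_image (Finset.Ioc u j) lowbit
    ⟨j, Finset.mem_Ioc.2 ⟨h, le_rfl⟩⟩
  rw [Finset.mem_Ioc] at hT
  have hle : lowbit T ≤ T := lowbit_le (by omega)
  have hpos : 1 ≤ lowbit T := Nat.one_le_two_pow
  obtain ⟨k, hk⟩ : lowbit T ∣ T := pow_padicValNat_dvd
  have hodd : ¬ 2 ∣ k := by
    rintro ⟨l, rfl⟩
    refine pow_succ_padicValNat_not_dvd (p := 2) (n := T) (by omega) ⟨l, ?_⟩
    conv_lhs => rw [hk]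
    rw [pow_succ, lowbit]; ring
  -- Since `T` is an odd multiple of `lowbit T`, its two neighbours among the multiples are even
  -- ones.
  have hle2 : ∀ x, x ≠ 0 → (∃ l, x = lowbit T * (2 * l)) → 2 * lowbit T ≤ lowbit x := by
    rintro x hx ⟨l, hl⟩
    have : 2 ^ (padicValNat 2 T + 1) ≤ lowbit x := by
      refine pow_le_lowbit hx ⟨l, ?_⟩
      rw [hl, pow_succ, lowbit]; ring
    rw [pow_succ] at this
    rw [lowbit]; omega
  refine ⟨T, hT.1, hT.2, ?_, ?_⟩
  · by_contra! hc
    have h1 := hmax (T - lowbit T) (Finset.mem_Ioc.2 ⟨hc, by omega⟩)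
    have h2 := hle2 (T - lowbit T) (by omega) ⟨(k - 1) / 2, by
      rw [Nat.mul_div_cancel' (by omega), Nat.mul_sub, ← hk, mul_one]⟩
    omega
  · by_contra! hc
    have h1 := hmax (T + lowbit T) (Finset.mem_Ioc.2 ⟨by omega, hc⟩)
    have h2 := hle2 (T + lowbit T) (by omega) ⟨(k + 1) / 2, by
      rw [Nat.mul_div_cancel' (by omega), Nat.mul_add, ← hk, mul_one]⟩
    omega

/-! ### Edges and uncovered pairs in the course of the column sweep -/

section Columns

variable {n : ℕ} {N G U : ℕ → ℕ → Prop}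

/-- Whether `(i, j)` becomes an edge is decided once, when column `j` is reached. Block updates that
later touch this column are harmless. -/
theorem columnState_fst {t i j : ℕ} :
    (columnState n N G U t).1 i j ↔ G i j ∨ j < t ∧ (columnState n N G U j).2 i j := by
  induction t with
  | zero => simp [columnState]
  | succ t ih =>
    simp only [columnState, ih, or_assoc]
    refine or_congr_right ⟨?_, ?_⟩
    · rintro (⟨h1, h2⟩ | ⟨rfl, h2⟩)
      exacts [⟨by omega, h2⟩, ⟨by omega, h2⟩]
    · rintro ⟨h1, h2⟩
      rcases (Nat.lt_succ_iff.1 h1).eq_or_lt with rfl | h1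
      exacts [.inr ⟨rfl, h2⟩, .inl ⟨h1, h2⟩]

theorem columnState_fst_mono {t t' i j : ℕ} (ht : t ≤ t')
    (h : (columnState n N G U t).1 i j) : (columnState n N G U t').1 i j := by
  rw [columnState_fst] at h ⊢
  exact h.imp_right fun h => ⟨by omega, h.2⟩

theorem columnState_snd_anti {t t' i j : ℕ} (ht : t ≤ t')
    (h : (columnState n N G U t').2 i j) : (columnState n N G U t).2 i j := by
  induction t', ht using Nat.le_induction with
  | base => exact h
  | succ t' _ ih => exact ih h.1

/-- A pair stops being uncovered only in a block update, which has a witness, and edges are never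
removed. -/
theorem exists_cover_of_not_uncovered {t i j : ℕ} (hU : U i j)
    (h : ¬ (columnState n N G U t).2 i j) :
    ∃ u < n, (columnState n N G U t).1 i u ∧ N u j := by
  induction t with
  | zero => exact absurd hU h
  | succ t ih =>
    by_cases h1 : (columnState n N G U t).2 i j
    · have h2 : ¬ stayUncovered n (t + 1 - lowbit (t + 1)) (2 * lowbit (t + 1)) N
        (columnState n N G U (t + 1)).1 (columnState n N G U t).2 i j := h
      rw [stayUncovered, not_and, not_not] at h2
      obtain ⟨-, -, u, -, -, hu, hG, hN⟩ := h2 h1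
      exact ⟨u, hu, hG, hN⟩
    · obtain ⟨u, hu, hG, hN⟩ := ih h1
      exact ⟨u, hu, columnState_fst_mono (Nat.le_succ t) hG, hN⟩

/-- This is where the lazy updates are seen to be timely: the block of `exists_lowbit_block` is
processed after the edge `(i, u)` is chosen and before column `j` is reached. -/
theorem not_near_of_uncovered {i u j : ℕ} (huj : u < j) (hjn : j < n)
    (hu : (columnState n N G U u).2 i u) (hj : (columnState n N G U j).2 i j) : ¬ N u j := by
  intro hN
  obtain ⟨T, h1, h2, h3, h4⟩ := exists_lowbit_block huj
  obtain ⟨t, rfl⟩ : ∃ t, T = t + 1 := ⟨T - 1, by omega⟩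
  have hle : lowbit (t + 1) ≤ t + 1 := lowbit_le (by omega)
  have h5 : stayUncovered n (t + 1 - lowbit (t + 1)) (2 * lowbit (t + 1)) N
        (columnState n N G U (t + 1)).1 (columnState n N G U t).2 i j :=
    columnState_snd_anti h2 hj
  exact h5.2 ⟨by omega, by omega, u, h3, by omega, by omega,
    columnState_fst.2 (.inr ⟨h1, hu⟩), hN⟩

end Columns

/-- The first `n` numbers form a metric space, and the parameters are in the range considered. -/
structure RealInput.IsMetric (I : RealInput) (n : ℕ) : Prop where
  self : ∀ i < n, I.dist i i = 0
  pos : ∀ i < n, ∀ j < n, i ≠ j → 0 < I.dist i j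
  symm : ∀ i < n, ∀ j < n, I.dist i j = I.dist j i
  triangle : ∀ i < n, ∀ j < n, ∀ k < n, I.dist i k ≤ I.dist i j + I.dist j k
  alpha : 0 < I.alpha
  oneAddEps : 1 < I.oneAddEps

/-- The state of the greedy algorithm when all pairs at distance less than `r` are covered. -/
structure IsGreedy (I : RealInput) (n : ℕ) (r : ℝ) (G : ℕ → ℕ → Prop) : Prop where
  lt : ∀ i j, G i j → j < n ∧ 0 < I.dist i j ∧ I.dist i j < r
  separated : ∀ i < n, ∀ j j', G i j → G i j' → j ≠ j' → ∀ u < n,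
    ¬ (I.dist u j < I.dist i j / (2 * I.alpha * I.oneAddEps) ∧
      I.dist u j' < I.dist i j' / (2 * I.alpha * I.oneAddEps))
  cover : ∀ i < n, ∀ j < n, i ≠ j → I.dist i j < r →
    ∃ u < n, G i u ∧ I.dist u j < I.dist i j / I.alpha

/-- This explains the factor $2\alpha(1+\varepsilon)$: the $1+\varepsilon$ absorbs the width of the
scale, and the $2$ pays for the triangle inequality through `u`. -/
theorem RealInput.IsMetric.dist_lt {I : RealInput} {n : ℕ} (hI : I.IsMetric n) {i j j' u : ℕ}
    (hj : j < n) (hj' : j' < n) (hu : u < n) {r : ℝ}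
    (h1 : I.dist i j < r * I.oneAddEps) (h2 : I.dist i j' < r * I.oneAddEps)
    (h3 : I.dist u j < I.dist i j / (2 * I.alpha * I.oneAddEps))
    (h4 : I.dist u j' < I.dist i j' / (2 * I.alpha * I.oneAddEps)) :
    I.dist j j' < r / I.alpha := by
  have ha := hI.alpha
  have hc : 0 < I.oneAddEps := zero_lt_one.trans hI.oneAddEps
  have hb : 0 < 2 * I.alpha * I.oneAddEps := by positivity
  have e : r * I.oneAddEps / (2 * I.alpha * I.oneAddEps) = r / I.alpha / 2 := by
    field_simp
  have h5 := h3.trans (div_lt_div_of_pos_right h1 hb)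
  have h6 := h4.trans (div_lt_div_of_pos_right h2 hb)
  rw [e] at h5 h6
  have h7 := hI.triangle j hj u hu j' hj'
  rw [hI.symm j hj u hu] at h7
  linarith

theorem IsGreedy.scaleGraph {I : RealInput} {n : ℕ} (hI : I.IsMetric n) {r : ℝ} (hr : 0 < r)
    {G : ℕ → ℕ → Prop} (hG : IsGreedy I n r G) :
    IsGreedy I n (r * I.oneAddEps) (scaleGraph I n r G) := by
  set N : ℕ → ℕ → Prop := fun u j => I.dist u j < r / I.alpha with hN
  set U : ℕ → ℕ → Prop := fun i j => (r ≤ I.dist i j ∧ I.dist i j < r * I.oneAddEps) ∧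
      ¬ ∃ u < n, G i u ∧ I.dist u j < r / I.alpha with hU
  have hr' : r < r * I.oneAddEps := lt_mul_of_one_lt_right hr hI.oneAddEps
  have hmem : ∀ i j, SparseNav.scaleGraph I n r G i j ↔
      G i j ∨ j < n ∧ (columnState n N G U j).2 i j := fun i j => columnState_fst
  have hnew : ∀ i j, (columnState n N G U j).2 i j → U i j := fun i j h =>
    columnState_snd_anti (Nat.zero_le j) h
  refine ⟨fun i j h => ?_, ?_, fun i hi j hj hne hlt => ?_⟩
  · rcases (hmem i j).1 h with h | ⟨h, h'⟩
    · have := hG.lt i j h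
      exact ⟨this.1, this.2.1, this.2.2.trans hr'⟩
    · have := (hnew i j h').1
      exact ⟨h, hr.trans_le this.1, this.2⟩
  · rintro i hi j j' h h' hne u hu ⟨h1, h2⟩
    -- Two old edges are separated by assumption. An old edge would have kept a new one from being
    -- uncovered at the start of the scale, and of two new edges the one in the earlier column would
    -- have covered the other.
    rcases (hmem i j).1 h with h | ⟨h, hj⟩ <;> rcases (hmem i j').1 h' with h' | ⟨h', hj'⟩
    · exact hG.separated i hi j j' h h' hne u hu ⟨h1, h2⟩
    · have hlt := hG.lt i j h
      exact (hnew i j' hj').2 ⟨j, hlt.1, h, hI.dist_lt hlt.1 h' hu (hlt.2.2.trans hr')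
        (hnew i j' hj').1.2 h1 h2⟩
    · have hlt := hG.lt i j' h'
      exact (hnew i j hj).2 ⟨j', hlt.1, h', hI.dist_lt hlt.1 h hu (hlt.2.2.trans hr')
        (hnew i j hj).1.2 h2 h1⟩
    · rcases lt_or_gt_of_ne hne with hlt | hlt
      · exact not_near_of_uncovered hlt h' hj hj'
          (hI.dist_lt h h' hu (hnew i j hj).1.2 (hnew i j' hj').1.2 h1 h2)
      · exact not_near_of_uncovered hlt h hj' hj
          (hI.dist_lt h' h hu (hnew i j' hj').1.2 (hnew i j hj).1.2 h2 h1)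
  · rcases lt_or_ge (I.dist i j) r with h | h
    · obtain ⟨u, hu, h1, h2⟩ := hG.cover i hi j hj hne h
      exact ⟨u, hu, (hmem i u).2 (.inl h1), h2⟩
    · suffices ∃ u < n, SparseNav.scaleGraph I n r G i u ∧ N u j by
        obtain ⟨u, hu, h1, h2⟩ := this
        exact ⟨u, hu, h1, h2.trans_le (div_le_div_of_nonneg_right h hI.alpha.le)⟩
      by_cases h1 : ∃ u < n, G i u ∧ I.dist u j < r / I.alpha
      · obtain ⟨u, hu, h1, h2⟩ := h1
        exact ⟨u, hu, (hmem i u).2 (.inl h1), h2⟩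
      · by_cases h2 : (columnState n N G U j).2 i j
        -- A pair still uncovered when its column is reached becomes an edge and covers itself, at
        -- distance zero.
        · refine ⟨j, hj, (hmem i j).2 (.inr ⟨hj, h2⟩), ?_⟩
          simp only [hN, hI.self j hj]
          exact div_pos hr hI.alpha
        · obtain ⟨u, hu, h3, h4⟩ := exists_cover_of_not_uncovered (U := U) ⟨⟨h, hlt⟩, h1⟩ h2
          exact ⟨u, hu, columnState_fst_mono hj.le h3, h4⟩

theorem isGreedy_graphAt {I : RealInput} {n : ℕ} (hI : I.IsMetric n) {r : ℝ} (hr : 0 < r)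
    (hr' : ∀ i < n, ∀ j < n, i ≠ j → r ≤ I.dist i j) (k : ℕ) :
    IsGreedy I n (r * I.oneAddEps ^ k) (graphAt I n r k) := by
  induction k with
  | zero =>
    refine ⟨fun _ _ h => h.elim, fun _ _ _ _ h => h.elim, fun i hi j hj hne hlt => ?_⟩
    rw [pow_zero, mul_one] at hlt
    exact absurd (hr' i hi j hj hne) (not_le.2 hlt)
  | succ k ih =>
    rw [pow_succ, ← mul_assoc]
    exact ih.scaleGraph hI (mul_pos hr (pow_pos (zero_lt_one.trans hI.oneAddEps) k))

/-- Map each edge `(p, q)` of `G` to an edge `(p, u)` of `H` that serves the pair. Separation makes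
this injective at every source, so both objectives compare with factor `1`; the factor `c` is slack.
-/
theorem isBicriteriaApprox_of_separated {P : Type*} [MetricSpace P] [Finite P] {α β c : ℝ}
    (hc : 1 ≤ c) {G : Digraph P} (hnav : IsNavigable α G)
    (hpos : ∀ p q, G.Adj p q → 0 < dist p q)
    (hsep : ∀ p q q', G.Adj p q → G.Adj p q' → q ≠ q' → ∀ u,
      ¬ (dist u q < dist p q / β ∧ dist u q' < dist p q' / β)) :
    IsBicriteriaApprox α β c G := by
  refine ⟨hnav, fun H hH => ?_⟩
  have hex : ∀ p q, ∃ u, G.Adj p q → H.Adj p u ∧ dist u q < dist p q / β := by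
    intro p q
    by_cases h : G.Adj p q
    · obtain ⟨u, hu⟩ := hH p q (hpos p q h)
      exact ⟨u, fun _ => hu⟩
    · exact ⟨p, fun h' => absurd h' h⟩
  choose f hf using hex
  have hinj : ∀ p q q', G.Adj p q → G.Adj p q' → f p q = f p q' → q = q' := by
    intro p q q' h h' he
    by_contra hne
    exact hsep p q q' h h' hne (f p q) ⟨(hf p q h).2, he ▸ (hf p q' h').2⟩
  have hdeg : ∀ p, outDegree G p ≤ outDegree H p := fun p =>
    Set.ncard_le_ncard_of_injOn (f p) (fun q hq => (hf p q hq).1)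
      (fun q hq q' hq' he => hinj p q q' hq hq' he) (Set.toFinite _)
  have hmax : maxOutDegree G ≤ maxOutDegree H :=
    ciSup_mono (Set.toFinite _).bddAbove hdeg
  have hedge : edgeCount G ≤ edgeCount H := by
    refine Set.ncard_le_ncard_of_injOn (fun x => (x.1, f x.1 x.2))
      (fun x hx => (hf x.1 x.2 hx).1) ?_ (Set.toFinite _)
    rintro ⟨p, q⟩ hx ⟨p', q'⟩ hy he
    obtain ⟨rfl, he⟩ := Prod.mk.inj he
    rw [hinj p q q' hx hy he]
  have h1 : ∀ a b : ℕ, a ≤ b → (a : ℝ) ≤ c * b := fun a b hab =>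
    (Nat.cast_le.2 hab).trans (le_mul_of_one_le_left (Nat.cast_nonneg b) hc)
  exact ⟨h1 _ _ hmax, h1 _ _ hedge⟩

theorem Multiplies.mono {mm : Cmd} {w : ℕ} {I : RealInput} {n M M' : ℕ}
    (h : Multiplies mm w I n M) (hM : M ≤ M') : Multiplies mm w I n M' :=
  fun A B s h1 h2 h3 h4 => (h A B s h1 h2 h3 h4).mono hM fun _ h => h

theorem metricInput_isMetric {P : Type*} [MetricSpace P] {n : ℕ} (e : Fin n ≃ P) {α ε : ℝ}
    (hα : 1 ≤ α) (hε : 0 < ε) : (metricInput e α ε).IsMetric n := by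
  have hd : ∀ i j (hi : i < n) (hj : j < n),
      (metricInput e α ε).dist i j = dist (e ⟨i, hi⟩) (e ⟨j, hj⟩) := by
    intro i j hi hj
    simp [metricInput, hi, hj]
  refine ⟨fun i hi => ?_, fun i hi j hj hne => ?_, fun i hi j hj => ?_,
    fun i hi j hj k hk => ?_, zero_lt_one.trans_le hα, ?_⟩
  · rw [hd i i hi hi, dist_self]
  · rw [hd i j hi hj, dist_pos]
    exact fun h => hne (Fin.mk.inj (e.injective h))
  · rw [hd i j hi hj, hd j i hj hi, dist_comm]
  · rw [hd i k hi hk, hd i j hi hj, hd j k hj hk]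
    exact dist_triangle _ _ _
  · change 1 < 1 + ε
    linarith

theorem isBicriteriaApprox_outputGraph {P : Type*} [MetricSpace P] {n : ℕ} (e : Fin n ≃ P)
    {α ε c r : ℝ} (hc : 1 ≤ c) {G : ℕ → ℕ → Prop} (hG : IsGreedy (metricInput e α ε) n r G)
    (hr : ∀ p q : P, dist p q < r) {s : State} (hs : Rep (s.arr 0) n G) :
    IsBicriteriaApprox α (2 * α * (1 + ε)) c (outputGraph e s) := by
  have : Finite P := .of_equiv _ e
  have hd : ∀ p q : P, (metricInput e α ε).dist (e.symm p) (e.symm q) = dist p q := by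
    intro p q
    simp [metricInput]
  have hadj : ∀ p q : P, (outputGraph e s).Adj p q ↔ G (e.symm p) (e.symm q) := by
    intro p q
    change s.arr 0 _ ≠ 0 ↔ _
    rcases hs.eq_of (e.symm p).2 (e.symm q).2 with ⟨h1, h2⟩ | ⟨h1, h2⟩ <;> simp [h1, h2]
  refine isBicriteriaApprox_of_separated hc (fun p q hpq => ?_) (fun p q h => ?_)
    fun p q q' h h' hne u => ?_
  · have hne : (e.symm p : ℕ) ≠ e.symm q := fun h =>
      (dist_pos.1 hpq) (e.symm.injective (Fin.ext h))
    obtain ⟨u, hu, h1, h2⟩ := hG.cover _ (e.symm p).2 _ (e.symm q).2 hne (by rw [hd]; exact hr p q)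
    refine ⟨e ⟨u, hu⟩, (hadj _ _).2 (by simpa using h1), ?_⟩
    have h3 := hd (e ⟨u, hu⟩) q
    rw [Equiv.symm_apply_apply] at h3
    rw [← h3, ← hd p q]
    exact h2
  · rw [← hd]
    exact (hG.lt _ _ ((hadj p q).1 h)).2.1
  · have := hG.separated _ (e.symm p).2 _ _ ((hadj p q).1 h) ((hadj p q').1 h')
      (fun he => hne (e.symm.injective (Fin.ext he))) _ (e.symm u).2
    rw [hd, hd, hd, hd] at this
    exact this

/-! ### The number of scales and the total running time -/

theorem exists_scale_count {mn mx ε : ℝ} (hmn : 0 < mn) (hle : mn ≤ mx) (hε : 0 < ε)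
    (hε' : ε < 1) : ∃ J : ℕ, (∀ k < J, mn * (1 + ε) ^ k ≤ mx) ∧ mx < mn * (1 + ε) ^ J ∧
      (J : ℝ) + 1 ≤ 2 * (1 + Real.log (mx / mn) / ε) := by
  classical
  have hex : ∃ J : ℕ, mx < mn * (1 + ε) ^ J := by
    obtain ⟨J, hJ⟩ := pow_unbounded_of_one_lt (mx / mn) (by linarith : 1 < 1 + ε)
    exact ⟨J, by rwa [div_lt_iff₀' hmn] at hJ⟩
  refine ⟨Nat.find hex, fun k hk => not_lt.1 (Nat.find_min hex hk), Nat.find_spec hex, ?_⟩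
  -- The last scale processed is still at most `mx`, which bounds its index `j`. The number of
  -- scales is one more, hence the summand `1` in the bound.
  obtain ⟨j, hj⟩ : ∃ j, Nat.find hex = j + 1 := by
    refine Nat.exists_eq_succ_of_ne_zero fun h0 => ?_
    have := Nat.find_spec hex
    rw [h0, pow_zero, mul_one] at this
    linarith
  have h1 : mn * (1 + ε) ^ j ≤ mx := not_lt.1 (Nat.find_min hex (by omega))
  have h2 : (j : ℝ) * Real.log (1 + ε) ≤ Real.log (mx / mn) := by
    rw [← Real.log_pow]
    exact Real.log_le_log (by positivity) (by rwa [le_div_iff₀' hmn])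
  -- From $\log(1+\varepsilon)\ge\varepsilon/(1+\varepsilon)$ and $\varepsilon<1$.
  have h3 : ε / 2 ≤ Real.log (1 + ε) := by
    refine le_trans ?_ (Real.one_sub_inv_le_log_of_pos (by linarith))
    have : 1 - (1 + ε)⁻¹ = ε / (1 + ε) := by field_simp; ring
    rw [this]
    exact div_le_div_of_nonneg_left hε.le (by linarith) (by linarith)
  have h4 : (j : ℝ) * (ε / 2) ≤ Real.log (mx / mn) :=
    (mul_le_mul_of_nonneg_left h3 (Nat.cast_nonneg j)).trans h2
  have h5 : (j : ℝ) ≤ 2 * (Real.log (mx / mn) / ε) := by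
    rw [← mul_div_assoc, le_div_iff₀ hε]; linarith
  rw [hj]; push_cast; linarith

theorem half_le_log {n : ℕ} (hn : 2 ≤ n) : 1 / 2 ≤ Real.log n := by
  have h1 : Real.log 2 ≤ Real.log n :=
    Real.log_le_log (by norm_num) (by exact_mod_cast hn)
  have := Real.log_two_gt_d9
  linarith

theorem natLog_add_one_le {n : ℕ} (hn : 2 ≤ n) : (Nat.log 2 n : ℝ) + 1 ≤ 4 * Real.log n := by
  have h1 : (2 : ℝ) ^ Nat.log 2 n ≤ n := by exact_mod_cast Nat.pow_log_le_self 2 (by omega)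
  have h2 : (Nat.log 2 n : ℝ) * Real.log 2 ≤ Real.log n := by
    rw [← Real.log_pow]
    exact Real.log_le_log (by positivity) h1
  have h3 := Real.log_two_gt_d9
  have h4 : (Nat.log 2 n : ℝ) * (1 / 2) ≤ Nat.log 2 n * Real.log 2 :=
    mul_le_mul_of_nonneg_left (by linarith) (Nat.cast_nonneg _)
  have := half_le_log hn
  linarith

/-- The time of the products of `m × m` matrices, `m ≤ 2 * n`, per entry. -/
noncomputable def entryCost (C ω : ℝ) (k n : ℕ) : ℕ :=
  ⌈C * (2 * n : ℝ) ^ (ω - 2) * Real.log (2 * n) ^ k⌉₊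

/-- Because `2 ≤ ω`, the cost bound divided by `m ^ 2` is nondecreasing in `m`, so the value at `2 *
n` serves all block sizes. -/
theorem floor_le_entryCost {C ω : ℝ} {k n m : ℕ} (hC : 0 ≤ C) (hω : 2 ≤ ω) (hm : 2 ≤ m)
    (hmn : m ≤ 2 * n) : ⌊C * (m : ℝ) ^ ω * Real.log m ^ k⌋₊ ≤ entryCost C ω k n * (m * m) := by
  have hm0 : (0 : ℝ) < m := by exact_mod_cast (by omega : 0 < m)
  have hmn' : (m : ℝ) ≤ 2 * n := by exact_mod_cast hmn
  have hlog : 0 ≤ Real.log m := Real.log_natCast_nonneg m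
  refine Nat.floor_le_of_le ?_
  push_cast
  calc C * (m : ℝ) ^ ω * Real.log m ^ k
      = C * (m : ℝ) ^ (ω - 2) * Real.log m ^ k * (m * m) := by
        have : (m : ℝ) ^ ω = (m : ℝ) ^ (ω - 2) * (m * m) := by
          rw [← pow_two, ← Real.rpow_natCast, ← Real.rpow_add hm0]
          congr 1; push_cast; ring
        rw [this]; ring
    _ ≤ C * (2 * n : ℝ) ^ (ω - 2) * Real.log (2 * n) ^ k * (m * m) := by
        have h1 : (m : ℝ) ^ (ω - 2) ≤ (2 * n : ℝ) ^ (ω - 2) :=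
          Real.rpow_le_rpow hm0.le hmn' (by linarith)
        have h2 : Real.log m ≤ Real.log (2 * n) := Real.log_le_log hm0 hmn'
        have h3 : Real.log m ^ k ≤ Real.log (2 * n) ^ k := pow_le_pow_left₀ hlog h2 k
        have h4 : 0 ≤ (2 * n : ℝ) ^ (ω - 2) := by positivity
        gcongr
    _ ≤ entryCost C ω k n * (m * m) :=
        mul_le_mul_of_nonneg_right (Nat.le_ceil _) (by positivity)

theorem cost_le {C ω : ℝ} {k n J : ℕ} {x : ℝ} (hC : 0 ≤ C) (hω : 2 ≤ ω) (hn : 2 ≤ n)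
    (hJ : (J : ℝ) + 1 ≤ 2 * (1 + x)) :
    (((J + 1) * ((7 * entryCost C ω k n + 360) * (n * (n * (Nat.log 2 n + 1)))) : ℕ) : ℝ) ≤
      8 * ((7 * C * 2 ^ (ω - 2) + 367) * 2 ^ k) * (n : ℝ) ^ ω * Real.log n ^ (k + 1) *
        (1 + x) := by
  have hn0 : (0 : ℝ) < n := by exact_mod_cast (by omega : 0 < n)
  have hn1 : (1 : ℝ) ≤ n := by exact_mod_cast (by omega : 1 ≤ n)
  have hlog := half_le_log hn
  have hlog0 : 0 ≤ Real.log n := by linarith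
  set X := (n : ℝ) ^ (ω - 2) * Real.log n ^ k with hX
  have hX0 : 0 ≤ X := by positivity
  -- As `log n` may be less than `1`, the factor `2 ^ k` is needed here. It lets additive constants
  -- be absorbed into multiples of `2 ^ k * X`.
  have hX1 : 1 ≤ 2 ^ k * X := by
    have h1 : 1 ≤ (n : ℝ) ^ (ω - 2) := Real.one_le_rpow hn1 (by linarith)
    have h2 : 1 ≤ (2 * Real.log n) ^ k := one_le_pow₀ (by linarith)
    calc (1 : ℝ) = 1 * 1 := by ring
      _ ≤ (n : ℝ) ^ (ω - 2) * (2 * Real.log n) ^ k := mul_le_mul h1 h2 zero_le_one (by positivity)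
      _ = 2 ^ k * X := by rw [hX, mul_pow]; ring
  have hD : (entryCost C ω k n : ℝ) ≤ C * 2 ^ (ω - 2) * (2 ^ k * X) + 1 := by
    have hl2 : 0 ≤ Real.log (2 * n) := Real.log_nonneg (by linarith)
    refine (Nat.ceil_lt_add_one (by positivity)).le.trans ?_
    refine add_le_add_left ?_ 1
    have h1 : Real.log (2 * n) ≤ 2 * Real.log n := by
      rw [Real.log_mul (by norm_num) hn0.ne', two_mul]
      exact add_le_add_left (Real.log_le_log (by norm_num) (by exact_mod_cast hn)) _
    have h2 : Real.log (2 * n) ^ k ≤ (2 * Real.log n) ^ k := pow_le_pow_left₀ hl2 h1 k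
    calc C * (2 * n : ℝ) ^ (ω - 2) * Real.log (2 * n) ^ k
        ≤ C * (2 * n : ℝ) ^ (ω - 2) * (2 * Real.log n) ^ k :=
          mul_le_mul_of_nonneg_left h2 (by positivity)
      _ = C * 2 ^ (ω - 2) * (2 ^ k * X) := by
          rw [Real.mul_rpow (by norm_num) hn0.le, hX, mul_pow]; ring
  -- The number `367` is `360` plus `7` for the rounding up in `entryCost`. The `8` in the final
  -- constant is `2` from the number of scales times `4` from the binary logarithm.
  have hE : (7 * entryCost C ω k n + 360 : ℝ) ≤ (7 * C * 2 ^ (ω - 2) + 367) * 2 ^ k * X := by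
    nlinarith
  have hL := natLog_add_one_le hn
  have hnω : (n : ℝ) ^ ω = (n : ℝ) ^ (ω - 2) * (n * n) := by
    rw [← pow_two, ← Real.rpow_natCast, ← Real.rpow_add hn0]
    congr 1; push_cast; ring
  have hx : 0 ≤ 2 * (1 + x) := le_trans (by positivity) hJ
  push_cast
  calc ((J : ℝ) + 1) * ((7 * entryCost C ω k n + 360) * (n * (n * (Nat.log 2 n + 1))))
      ≤ (2 * (1 + x)) * (((7 * C * 2 ^ (ω - 2) + 367) * 2 ^ k * X) *
          (n * (n * (4 * Real.log n)))) := by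
        gcongr
    _ = _ := by rw [hnω, hX, pow_succ]; ring

end SparseNav

/-! ### Assembly of the theorem -/

open SparseNav in
theorem theorem5p3 :
    ∃ A : ℝ, ∀ ω : ℝ, SparseNav.IsMatMulExponent ω →
      ∃ (prog : SparseNav.Cmd) (C : ℝ) (k K : ℕ),
        ∀ (n : ℕ), 2 ≤ n → ∀ (P : Type*) [MetricSpace P] (e : Fin n ≃ P) (α ε : ℝ),
          1 ≤ α → 0 < ε → ε < 1 →
          ∀ w : ℕ, n ^ K ≤ 2 ^ w →
          ∀ s : SparseNav.State, s.Valid w → s.var 0 = n →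
            ∃ T : ℕ,
              (T : ℝ) ≤ C * (n : ℝ) ^ ω * Real.log n ^ k *
                (1 + Real.log (SparseNav.aspectRatio P) / ε) ∧
              (∀ c ∈ (SparseNav.runFor w (SparseNav.metricInput e α ε) T ([prog], s)).support,
                c.1 = []) ∧
              1 - 1 / (n : ℝ) ≤
                ((SparseNav.runFor w (SparseNav.metricInput e α ε) T ([prog], s)).toOuterMeasure
                  {c | SparseNav.IsBicriteriaApprox α (2 * α * (1 + ε)) (A * Real.log n)
                    (SparseNav.outputGraph e c.2)}).toReal := by
  -- The value `2` is chosen only to have `2 * log n ≥ 1` for all `n ≥ 2`.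
  refine ⟨2, fun ω hω => ?_⟩
  obtain ⟨mm, hmm, C, k, K, H⟩ := hω
  have hsq : ∀ n : ℕ, 2 ≤ n → (n : ℝ) ^ 2 ≤ C * (n : ℝ) ^ ω * Real.log n ^ k :=
    fun n hn => sq_le_of_matMul hmm H hn
  have hω2 : 2 ≤ ω := two_le_of_sq_le hsq
  have hC : 0 ≤ C := by
    by_contra! hC
    have h1 := hsq 2 le_rfl
    have h2 : C * ((2 : ℕ) : ℝ) ^ ω * Real.log (2 : ℕ) ^ k ≤ 0 := by
      refine mul_nonpos_of_nonpos_of_nonneg (mul_nonpos_of_nonpos_of_nonneg hC.le ?_) ?_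
      · positivity
      · exact pow_nonneg (Real.log_natCast_nonneg 2) k
    norm_num at h1 h2
    linarith
  obtain ⟨B, hB⟩ := mm.exists_writes_lt
  have hfresh : Fresh B mm := ⟨fun i => (hB (B + i) (by omega)).1, fun i => (hB (B + i) (by omega)).2,
    hmm.not_writesReal⟩
  -- Blocks have size at most `2 * n ≤ n ^ 2`, so the multiplication program needs $n^{2K}\le2^w$.
  -- The `7` ensures `16 * (n * n) < 2 ^ w`, since $2^5n^2\le n^7$.
  refine ⟨Prog.main B mm, 8 * ((7 * C * 2 ^ (ω - 2) + 367) * 2 ^ k), k + 1, 2 * K + 7, fun n hn P _ e α ε hα hε hε' w hw s hs h0 => ?_⟩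
  have hn0 : 0 < n := by omega
  have hW : 16 * (n * n) < 2 ^ w := by
    refine lt_of_lt_of_le ?_ ((Nat.pow_le_pow_right hn0 (by omega : 7 ≤ 2 * K + 7)).trans hw)
    have h5 : 2 ^ 5 ≤ n ^ 5 := Nat.pow_le_pow_left hn 5
    calc 16 * (n * n) < 2 ^ 5 * (n * n) := by nlinarith
      _ ≤ n ^ 5 * (n * n) := Nat.mul_le_mul_right _ h5
      _ = n ^ 7 := by ring
  have hw1 : 1 ≤ w := by
    by_contra! hc
    obtain rfl : w = 0 := by omega
    have := Nat.mul_le_mul hn hn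
    omega
  set I := metricInput e α ε with hI
  have hmet : I.IsMetric n := metricInput_isMetric e hα hε
  have hM : ∀ m, 2 ≤ m → m ≤ 2 * n → Multiplies mm w I m (entryCost C ω k n * (m * m)) := by
    intro m hm hmn
    have hmw : m ^ K ≤ 2 ^ w :=
      calc m ^ K ≤ (n * n) ^ K :=
            Nat.pow_le_pow_left (hmn.trans (Nat.mul_le_mul_right _ hn)) K
        _ = n ^ (2 * K) := by rw [← pow_two, ← pow_mul]
        _ ≤ n ^ (2 * K + 7) := Nat.pow_le_pow_right hn0 (by omega)
        _ ≤ 2 ^ w := hw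
    exact (multiplies_of_matMul hmm H hm hmw I).mono (floor_le_entryCost hC hω2 hm hmn)
  have hd : ∀ p q : P, I.dist (e.symm p) (e.symm q) = dist p q := by
    intro p q
    simp [hI, metricInput]
  have hd' : ∀ i j (hi : i < n) (hj : j < n), I.dist i j = dist (e ⟨i, hi⟩) (e ⟨j, hj⟩) := by
    intro i j hi hj
    simp [hI, metricInput, hi, hj]
  have : Finite P := .of_equiv _ e
  have : Nonempty P := ⟨e ⟨0, hn0⟩⟩
  have : Nonempty {p : P × P // p.1 ≠ p.2} :=
    ⟨⟨(e ⟨0, hn0⟩, e ⟨1, hn⟩), fun h => absurd (e.injective h) (by simp)⟩⟩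
  obtain ⟨a, ha⟩ := exists_eq_ciSup_of_finite (f := fun p : P × P => dist p.1 p.2)
  obtain ⟨b, hb⟩ := exists_eq_ciInf_of_finite
    (f := fun p : {p : P × P // p.1 ≠ p.2} => dist p.1.1 p.1.2)
  have hΔ : aspectRatio P = dist a.1 a.2 / dist b.1.1 b.1.2 := by
    rw [aspectRatio, ← ha, ← hb]
  have hle1 : ∀ p q : P, dist p q ≤ dist a.1 a.2 := fun p q => by
    rw [ha]
    exact le_ciSup (f := fun p : P × P => dist p.1 p.2) (Set.finite_range _).bddAbove (p, q)
  have hle2 : ∀ p q : P, p ≠ q → dist b.1.1 b.1.2 ≤ dist p q := fun p q h => by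
    rw [hb]
    exact ciInf_le (f := fun p : {p : P × P // p.1 ≠ p.2} => dist p.1.1 p.1.2)
      (Set.finite_range _).bddBelow ⟨(p, q), h⟩
  have hpos : 0 < dist b.1.1 b.1.2 := dist_pos.2 b.2
  obtain ⟨J, hJ1, hJ2, hJ3⟩ := exists_scale_count hpos (hle1 _ _) hε hε'
  have hrun := does_main hw1 hW hs hfresh hn hM h0
    (mx := dist a.1 a.2) (mn := dist b.1.1 b.1.2) (J := J)
    ⟨_, (e.symm a.1).2, _, (e.symm a.2).2, (hd _ _).symm⟩
    (fun i hi j hj => by rw [hd' i j hi hj]; exact hle1 _ _)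
    ⟨_, (e.symm b.1.1).2, _, (e.symm b.1.2).2,
      fun h => b.2 (e.symm.injective (Fin.ext h)), (hd _ _).symm⟩
    (fun i hi j hj hne => by
      rw [hd' i j hi hj]
      exact hle2 _ _ fun h => hne (Fin.mk.inj (e.injective h)))
    hJ1 hJ2
  obtain ⟨T, hT, s', hr, hs'⟩ := hrun
  refine ⟨T, ?_, fun c hc => ?_, ?_⟩
  · rw [hΔ]
    exact (Nat.cast_le.2 hT).trans (cost_le hC hω2 hn hJ3)
  · rw [hr [], PMF.support_pure, Set.mem_singleton_iff] at hc
    rw [hc]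
  · have hgreedy := isGreedy_graphAt hmet hpos (fun i hi j hj hne => by
      rw [hd' i j hi hj]
      exact hle2 _ _ fun h => hne (Fin.mk.inj (e.injective h))) J
    have hgood := isBicriteriaApprox_outputGraph e (α := α) (ε := ε) (c := 2 * Real.log n)
      (by have := half_le_log hn; linarith) hgreedy (fun p q => (hle1 p q).trans_lt hJ2) hs'
    -- The final distribution is a point mass, so the good event has probability `1`.
    rw [hr [], PMF.toOuterMeasure_pure_apply, if_pos, ENNReal.toReal_one]
    · have : (0 : ℝ) ≤ 1 / n := by positivity
      linarith
    · exact hgood
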